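/- Let $\mathcal M,\mathcal N$ be non-empty, compact, locally connected Hausdorff spaces that are homeomorphic, let $k\ge 1$, and let $\vec\varphi=(\varphi_1,\dots,\varphi_k):\mathcal M\to\mathbb R^k$ and $\vec\psi=(\psi_1,\dots,\psi_k):\mathcal N\to\mathbb R^k$ be continuous. *Natural pseudo-distance.* Put $d((\mathcal M,\vec\varphi),(\mathcal N,\vec\psi))=\inf_f\max_{P\in\mathcal M}\|\vec\varphi(P)-\vec\psi(f(P))\|_\infty$, where $f$ ranges over all homeomorphisms $\mathcal M\to\mathcal N$. *Admissible pairs.* Let $Adm_k$ be the set of pairs $(\vec l,\vec b)\in\mathbb R^k\times\mathbb R^k$ such that $l_i>0$ for all $i$, $\sum_i l_i^2=1$ and $\sum_i b_i=0$. For $(\vec l,\vec b)\in Adm_k$ put $F^{\vec\varphi}_{(\vec l,\vec b)}(P)=\max_{1\le i\le k}\frac{\varphi_i(P)-b_i}{l_i}$, and define $F^{\vec\psi}_{(\vec l,\vec b)}$ likewise. *Size functions.* For a continuous $F:\mathcal M\to\mathbb R$ and reals $x<y$, $\ell_{(\mathcal M,F)}(x,y)$ is the number of classes into which $\{F\le x\}$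 is divided by the relation "$P$ and $Q$ lie in a common connected subset of $\{F\le y\}$". *Matching distance.* For a size function $\ell=\ell_{(\mathcal M,F)}$ and $x<y$, the multiplicity of $(x,y)$ is the minimum, over $\varepsilon>0$ with $x+\varepsilon<y-\varepsilon$, of $\ell(x+\varepsilon,y-\varepsilon)-\ell(x-\varepsilon,y-\varepsilon)-\ell(x+\varepsilon,y+\varepsilon)+\ell(x-\varepsilon,y+\varepsilon)$; the multiplicity of $(x,\infty)$ is the minimum, over $\varepsilon>0$ with $x+\varepsilon<1/\varepsilon$, of $\ell(x+\varepsilon,1/\varepsilon)-\ell(x-\varepsilon,1/\varepsilon)$. Let $C(\ell)$ be the multiset of all these points $(x,y)$ and $(x,\infty)$ taken with their multiplicities, together with all diagonal points $(x,x)$, $x\in\mathbb R$, each taken countably infinitely many times. Put $$\delta((x,y),(x',y'))=\min\Big\{\max\{|x-x'|,|y-y'|\},\ \max\big\{\tfrac{y-x}{2},\tfrac{y'-x'}{2}\big\}\Big\},$$ with $|\infty-\infty|=0$ and $|\infty-y|=\infty-y=\infty/2=\infty$ for real $y$. Then $d_{match}(\ell_1,\ell_2)=\inf_\sigma\sup_{p\in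 C(\ell_1)}\delta(p,\sigma(p))$, where $\sigma$ ranges over all bijections $C(\ell_1)\to C(\ell_2)$. **Theorem.** The number $d((\mathcal M,\vec\varphi),(\mathcal N,\vec\psi))$ is finite, and $$\sup_{(\vec l,\vec b)\in Adm_k}\ \min_{1\le i\le k} l_i\cdot d_{match}\big(\ell_{(\mathcal M,F^{\vec\varphi}_{(\vec l,\vec b)})},\ell_{(\mathcal N,F^{\vec\psi}_{(\vec l,\vec b)})}\big)\ \le\ d((\mathcal M,\vec\varphi),(\mathcal N,\vec\psi)).$$ In other words, the multidimensional matching distance $D_{match}(\ell_{(\mathcal M,\vec\varphi)},\ell_{(\mathcal N,\vec\psi)})$, which is defined to be the supremum on the left, is a lower bound for $d$. -/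

import Mathlib

open scoped ENNReal

noncomputable section

namespace SizeTheory

/-- The lower level set of `φ` at `x`: the set of points `P` with `φ P ≤ x`. The codomain `α` is
`ℝ` for one-dimensional measuring functions and `Fin k → ℝ`, with the componentwise order, for
`k`-dimensional ones. -/
def lowerLevel {M α : Type*} [Preorder α] (φ : M → α) (x : α) : Set M :=
  {P | φ P ≤ x}

/-- Two points are `⟨φ ≼ y⟩`-connected if some connected subset of the lower level set at `y`
contains both. -/
def LevelConnected {M α : Type*} [TopologicalSpace M] [Preorder α] (φ : M → α) (y : α)
    (P Q : M) : Prop :=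
  ∃ S : Set M, IsConnected S ∧ S ⊆ lowerLevel φ y ∧ P ∈ S ∧ Q ∈ S

/-- For `x ≤ y` the relation of `⟨φ ≼ y⟩`-connectedness is an equivalence relation on the lower
level set at `x`, so that the quotient below is the set of its equivalence classes. -/
theorem levelConnected_equivalence {M α : Type*} [TopologicalSpace M] [Preorder α] (φ : M → α)
    {x y : α} (hxy : x ≤ y) :
    Equivalence (fun P Q : lowerLevel φ x => LevelConnected φ y (P : M) (Q : M)) where
  refl P := ⟨{(P : M)}, isConnected_singleton,
    Set.singleton_subset_iff.2 (le_trans P.2 hxy), rfl, rfl⟩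
  symm := fun ⟨S, h, hS, hP, hQ⟩ => ⟨S, h, hS, hQ, hP⟩
  trans := fun ⟨S, h, hS, hP, hQ⟩ ⟨T, h', hT, hQ', hR⟩ =>
    ⟨S ∪ T, IsConnected.union ⟨_, hQ, hQ'⟩ h h', Set.union_subset hS hT, Or.inl hP, Or.inr hR⟩

/-- The size function of `(M, φ)`: the number of classes into which the lower level set at `x` is
divided by `⟨φ ≼ y⟩`-connectedness. It is meaningful on the pairs with `x` strictly below `y` in
each coordinate, and only its values at such pairs are ever used. -/
def sizeFunction {M α : Type*} [TopologicalSpace M] [Preorder α] (φ : M → α) (x y : α) : ℕ :=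
  Nat.card (Quot (fun P Q : lowerLevel φ x => LevelConnected φ y (P : M) (Q : M)))

/-- A point `(x, y)` of the plane, or a vertical line `{x} × ℝ`, regarded as the point `(x, ∞)` at
infinity. -/
inductive ExtPoint : Type
  | finite (x y : ℝ) : ExtPoint
  | infinite (x : ℝ) : ExtPoint

/-- The multiplicity of a point `(x, y)`, `x < y`, or of a vertical line `(x, ∞)` for a
one-dimensional size function `ℓ`: the minimum, over the admitted `ε > 0`, of the alternating sums
of the values of `ℓ` below. If `y ≤ x`, no `ε` is admitted, and the value is `0`. -/
def cornerMult (ℓ : ℝ → ℝ → ℕ) : ExtPoint → ℕ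
  | .finite x y => sInf {n : ℕ | ∃ ε : ℝ, 0 < ε ∧ x + ε < y - ε ∧
      (n : ℤ) = (ℓ (x + ε) (y - ε) : ℤ) - ℓ (x - ε) (y - ε)
        - ℓ (x + ε) (y + ε) + ℓ (x - ε) (y + ε)}
  | .infinite x => sInf {n : ℕ | ∃ ε : ℝ, 0 < ε ∧ x + ε < 1 / ε ∧
      (n : ℤ) = (ℓ (x + ε) (1 / ε) : ℤ) - ℓ (x - ε) (1 / ε)}

/-- The multiset, presented as an indexing type, of all cornerpoints of `ℓ` (proper ones and those
at infinity), each taken as many times as its multiplicity, together with all the points of the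
diagonal, each taken countably many times. -/
def Diagram (ℓ : ℝ → ℝ → ℕ) : Type :=
  (Σ p : ExtPoint, Fin (cornerMult ℓ p)) ⊕ (ℝ × ℕ)

/-- The point underlying an element of the diagram. -/
def Diagram.point {ℓ : ℝ → ℝ → ℕ} : Diagram ℓ → ExtPoint
  | .inl a => a.1
  | .inr a => .finite a.1 a.1

/-- The cost of moving one point to another: the smaller of the max-norm distance of the two
points and of the cost of moving both to the diagonal. In the formula
`min (max |x - x'| |y - y'|) (max ((y - x) / 2) ((y' - x') / 2))`
the conventions for the ordinate `∞` are `|∞ - ∞| = 0` and `|∞ - y| = ∞ - y = ∞` for real `y`. -/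
def moveCost : ExtPoint → ExtPoint → ℝ≥0∞
  | .finite x y, .finite x' y' =>
      ENNReal.ofReal (min (max |x - x'| |y - y'|) (max ((y - x) / 2) ((y' - x') / 2)))
  | .infinite x, .infinite x' => ENNReal.ofReal |x - x'|
  | .finite _ _, .infinite _ => ⊤
  | .infinite _, .finite _ _ => ⊤

/-- The matching distance between one-dimensional size functions: the infimum, over all
bijections between the two diagrams, of the largest cost of moving a point to its partner. -/
def matchDist (ℓ₁ ℓ₂ : ℝ → ℝ → ℕ) : ℝ≥0∞ :=
  ⨅ σ : Diagram ℓ₁ ≃ Diagram ℓ₂, ⨆ a : Diagram ℓ₁, moveCost a.point (σ a).point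

/-- The set of admissible pairs `(l, b)`: `l` is a unit vector (for the Euclidean norm) with
positive coordinates, and the coordinates of `b` sum to zero. -/
def Adm (k : ℕ) : Set ((Fin k → ℝ) × (Fin k → ℝ)) :=
  {p | (∀ i, 0 < p.1 i) ∧ ∑ i, p.1 i ^ 2 = 1 ∧ ∑ i, p.2 i = 0}

/-- The smallest coordinate of a vector. -/
def minCoord {k : ℕ} [NeZero k] (l : Fin k → ℝ) : ℝ :=
  Finset.univ.inf' Finset.univ_nonempty l

/-- The one-dimensional measuring function `P ↦ max_i (φ_i(P) - b_i) / l_i`. -/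
def reduced {M : Type*} {k : ℕ} [NeZero k] (l b : Fin k → ℝ) (φ : M → Fin k → ℝ) (P : M) : ℝ :=
  Finset.univ.sup' Finset.univ_nonempty (fun i => (φ P i - b i) / l i)

/-- The multidimensional matching distance between the size functions of `(M, φ)` and
`(N, ψ)`. -/
def multiMatchDist {M N : Type*} [TopologicalSpace M] [TopologicalSpace N] {k : ℕ} [NeZero k]
    (φ : M → Fin k → ℝ) (ψ : N → Fin k → ℝ) : ℝ≥0∞ :=
  ⨆ p ∈ Adm k, ENNReal.ofReal (minCoord p.1) *
    matchDist (sizeFunction (reduced p.1 p.2 φ)) (sizeFunction (reduced p.1 p.2 ψ))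

/-- The natural pseudo-distance; `edist` on `Fin k → ℝ` is the distance of the max-norm. -/
def naturalPseudoDist {M N : Type*} [TopologicalSpace M] [TopologicalSpace N] {k : ℕ}
    (φ : M → Fin k → ℝ) (ψ : N → Fin k → ℝ) : ℝ≥0∞ :=
  ⨅ f : M ≃ₜ N, ⨆ P : M, edist (φ P) (ψ (f P))

end SizeTheory

end

/-! Everything reduces to one-dimensional stability: if `|F - G| ≤ h` on a compact locally connected
space, then the matching distance of the two size functions is at most `h`
(`matchDist_le_of_close`). Size functions are invariant under homeomorphisms, so `ψ` may be pulled
back along `f`; and if `φ` and `ψ ∘ f` differ by at most `c`, then the reduced functions differ by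
at most `c / min l_i` (`reduced_sub_le`). Multiplying by `min l_i` cancels the denominator.

Stability is proved by a direct matching through an intermediate rank function: `I x y`, the number
of components of `{G ≤ y + h}` that meet `{F ≤ x}`. It shares its lower sets with the size function
of `F`, and its upper sets with that of `G`. Accordingly its cornerpoints inject into those of `F`
with the abscissa preserved (`exists_birth_injection`), and into those of `G` with the ordinate
shifted by exactly `h` (`exists_death_injection`). The inclusions `{F ≤ y} ⊆ {G ≤ y + h} ⊆ {F ≤ y +
2h}` and `{G ≤ x - h} ⊆ {F ≤ x} ⊆ {G ≤ x + h}` control the other coordinate. Every cornerpoint with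
`y - x > 2h` is hit, and the missed ones can go to the diagonal at cost at most `h`.

Each injection sends the `i`-th cornerpoint on a vertical (or horizontal) line to the `i`-th one on
the corresponding line. The required comparison of counts comes from a single inequality,
`compCount_supermodular`: enlarging the lower set can only increase the number of components lost
when the upper set grows. -/

open Filter Topology Set

namespace SizeTheory

/-! ### Counting components of one set that meet another -/

section Components

variable {M : Type*} [TopologicalSpace M]

/-- The number of connected components of `Y` that meet `X`. -/
noncomputable def compCount (X Y : Set M) : ℕ := (connectedComponentIn Y '' X).ncard

theorem levelConnected_iff {α : Type*} [Preorder α] (φ : M → α) {y : α} {P Q : M}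
    (hP : φ P ≤ y) (hQ : φ Q ≤ y) :
    LevelConnected φ y P Q ↔
      connectedComponentIn (lowerLevel φ y) P = connectedComponentIn (lowerLevel φ y) Q := by
  constructor
  · rintro ⟨S, hS, hSy, hPS, hQS⟩
    exact connectedComponentIn_eq (hS.isPreconnected.subset_connectedComponentIn hPS hSy hQS)
  · intro h
    refine ⟨connectedComponentIn (lowerLevel φ y) P, isConnected_connectedComponentIn_iff.2 hP,
      connectedComponentIn_subset _ _, mem_connectedComponentIn hP, ?_⟩
    rw [h]
    exact mem_connectedComponentIn hQ

/-- In this form the two sets may be level sets of different functions, as the intermediate rank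
function requires. -/
theorem sizeFunction_eq_compCount {α : Type*} [Preorder α] (φ : M → α) {x y : α} (hxy : x ≤ y) :
    sizeFunction φ x y = compCount (lowerLevel φ x) (lowerLevel φ y) := by
  have key : ∀ P Q : lowerLevel φ x, LevelConnected φ y (P : M) (Q : M) ↔
      connectedComponentIn (lowerLevel φ y) P = connectedComponentIn (lowerLevel φ y) Q :=
    fun P Q => levelConnected_iff φ (le_trans P.2 hxy) (le_trans Q.2 hxy)
  let g : Quot (fun P Q : lowerLevel φ x => LevelConnected φ y (P : M) (Q : M)) →
      connectedComponentIn (lowerLevel φ y) '' lowerLevel φ x :=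
    Quot.lift (fun P => ⟨connectedComponentIn (lowerLevel φ y) P, mem_image_of_mem _ P.2⟩)
      (fun P Q h => Subtype.ext ((key P Q).1 h))
  have hg : Function.Bijective g := by
    constructor
    · rintro ⟨P⟩ ⟨Q⟩ h
      exact Quot.sound ((key P Q).2 (congrArg Subtype.val h))
    · rintro ⟨_, P, hP, rfl⟩
      exact ⟨Quot.mk _ ⟨P, hP⟩, rfl⟩
  exact Nat.card_congr (Equiv.ofBijective g hg)

/-- Local connectedness makes the components of `U` open, so finitely many of them cover `X`, and
each lies in a single component of `Y`. -/
theorem finite_components [LocallyConnectedSpace M] {X U Y : Set M} (hX : IsCompact X)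
    (hU : IsOpen U) (hXU : X ⊆ U) (hUY : U ⊆ Y) : (connectedComponentIn Y '' X).Finite := by
  obtain ⟨t, -, ht⟩ := hX.elim_nhds_subcover (connectedComponentIn U)
    fun P hP => hU.connectedComponentIn.mem_nhds (mem_connectedComponentIn (hXU hP))
  refine (t.finite_toSet.image (connectedComponentIn Y)).subset ?_
  rintro _ ⟨P, hP, rfl⟩
  obtain ⟨Q, hQ, hPQ⟩ := mem_iUnion₂.1 (ht hP)
  exact ⟨Q, hQ, connectedComponentIn_eq (connectedComponentIn_mono Q hUY hPQ)⟩

/-- Passing from `P` to `Q` adds at most `|Q \ P|` elements to the image. -/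
theorem ncard_image_add_ncard_le {α β : Type*} (f : α → β) {P Q : Set α} (hQ : Q.Finite)
    (hPQ : P ⊆ Q) : (f '' Q).ncard + P.ncard ≤ Q.ncard + (f '' P).ncard := by
  have h1 : f '' Q = f '' P ∪ f '' (Q \ P) := by
    rw [← image_union, union_sdiff_cancel hPQ]
  have h2 := ncard_union_le (f '' P) (f '' (Q \ P))
  have h3 := ncard_image_le (f := f) (hQ.sdiff (t := P))
  have h4 := ncard_sdiff_add_ncard_of_subset hPQ hQ
  rw [← h1] at h2
  omega

theorem exists_component_map {X Y Y' : Set M} (hXY : X ⊆ Y) (hY : Y ⊆ Y') :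
    ∃ f : Set M → Set M, ∀ P ∈ X, f (connectedComponentIn Y P) = connectedComponentIn Y' P := by
  refine ⟨fun C => ⋃ Q ∈ C, connectedComponentIn Y' Q, fun P hP => ?_⟩
  apply Subset.antisymm
  · refine iUnion₂_subset fun Q hQ => ?_
    rw [← connectedComponentIn_eq (connectedComponentIn_mono P hY hQ)]
  · exact subset_iUnion₂_of_subset P (mem_connectedComponentIn (hXY hP)) Subset.rfl

/-- Each component of `Y` lies in one of `Y'`, so both counts in `Y'` are sizes of images, under one
map, of the sets counted in `Y`. -/
theorem compCount_supermodular {X X' Y Y' : Set M} (hX : X ⊆ X') (hXY : X' ⊆ Y) (hY : Y ⊆ Y')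
    (hfin : (connectedComponentIn Y '' X').Finite) :
    compCount X' Y' + compCount X Y ≤ compCount X' Y + compCount X Y' := by
  obtain ⟨f, hf⟩ := exists_component_map hXY hY
  have h : ∀ Z ⊆ X', connectedComponentIn Y' '' Z = f '' (connectedComponentIn Y '' Z) := by
    intro Z hZ
    rw [image_image]
    exact image_congr fun P hP => (hf P (hZ hP)).symm
  unfold compCount
  rw [h X' Subset.rfl, h X hX]
  exact ncard_image_add_ncard_le f hfin (image_mono hX)

theorem compCount_mono_left {X X' Y : Set M} (hX : X ⊆ X')
    (hfin : (connectedComponentIn Y '' X').Finite) : compCount X Y ≤ compCount X' Y :=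
  ncard_le_ncard (image_mono hX) hfin

@[simp] theorem compCount_empty_left (Y : Set M) : compCount ∅ Y = 0 := by simp [compCount]

theorem finite_components_lowerLevel [CompactSpace M] [LocallyConnectedSpace M] {F G : M → ℝ}
    (hF : Continuous F) (hG : Continuous G) {x y : ℝ} (h : ∀ P, F P ≤ x → G P < y) :
    (connectedComponentIn (lowerLevel G y) '' lowerLevel F x).Finite :=
  finite_components (U := {P | G P < y}) (isClosed_le hF continuous_const).isCompact
    (isOpen_lt hG continuous_const) (fun P hP => h P hP) fun P (hP : G P < y) => hP.le

end Components

/-! ### Minima over small parameters as eventual values -/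

section Germs

/-- The smallest natural number among the values `N ε`, for the `ε > 0` satisfying `A`. -/
noncomputable def germ (A : ℝ → Prop) (N : ℝ → ℤ) : ℕ :=
  sInf {n : ℕ | ∃ ε : ℝ, 0 < ε ∧ A ε ∧ (n : ℤ) = N ε}

/-- The minimum is attained at some `ε₀`, and monotonicity forces the same value at every smaller
`ε`. Several minima can thus be evaluated at one common `ε`. -/
theorem eventually_germ {A : ℝ → Prop} {N : ℝ → ℤ} (hA : ∀ᶠ ε in 𝓝[>] (0 : ℝ), A ε)
    (hN : ∀ ε, 0 < ε → A ε → 0 ≤ N ε)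
    (hmono : ∀ ε ε', 0 < ε → ε ≤ ε' → A ε' → A ε ∧ N ε ≤ N ε') :
    ∀ᶠ ε in 𝓝[>] (0 : ℝ), A ε ∧ N ε = germ A N := by
  have hne : {n : ℕ | ∃ ε : ℝ, 0 < ε ∧ A ε ∧ (n : ℤ) = N ε}.Nonempty := by
    obtain ⟨ε, h1, h2⟩ := (hA.and self_mem_nhdsWithin).exists
    exact ⟨(N ε).toNat, ε, h2, h1, Int.toNat_of_nonneg (hN ε h2 h1)⟩
  obtain ⟨ε₀, h0, hA0, hN0⟩ := Nat.sInf_mem hne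
  filter_upwards [Ioo_mem_nhdsGT h0] with ε hε
  obtain ⟨h1, h2⟩ := hmono ε ε₀ hε.1 hε.2.le hA0
  refine ⟨h1, le_antisymm ?_ ?_⟩
  · rw [← hN0] at h2
    exact h2
  · have : germ A N ≤ (N ε).toNat :=
      Nat.sInf_le ⟨ε, hε.1, h1, Int.toNat_of_nonneg (hN ε hε.1 h1)⟩
    have h3 := hN ε hε.1 h1
    omega

/-- For a function of two small positive parameters that is monotone in both, the germ on the
diagonal is the iterated germ. -/
theorem diagonal_germ_eq {N : ℝ → ℝ → ℤ} {a b : ℤ} {E : ℝ} (hE : 0 < E)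
    (hmono : ∀ ε₁ ε₂ η₁ η₂, 0 < ε₁ → ε₁ ≤ ε₂ → ε₂ < E → 0 < η₁ → η₁ ≤ η₂ → η₂ < E →
      N ε₁ η₁ ≤ N ε₂ η₂)
    (hdiag : ∀ᶠ ε in 𝓝[>] (0 : ℝ), N ε ε = a)
    (hiter : ∀ᶠ η in 𝓝[>] (0 : ℝ), ∀ᶠ ε in 𝓝[>] (0 : ℝ), N ε η = b) : a = b := by
  obtain ⟨u, hu, hu'⟩ := mem_nhdsGT_iff_exists_Ioo_subset.1 hdiag
  obtain ⟨η, ⟨⟨hη, hηE⟩, hηu⟩, hηb⟩ :=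
    ((eventually_mem_set.2 (Ioo_mem_nhdsGT hE)).and
      (eventually_mem_set.2 (Ioo_mem_nhdsGT hu)) |>.and hiter).exists
  obtain ⟨ε, hεb, hε⟩ := (hηb.and (eventually_mem_set.2 (Ioo_mem_nhdsGT hη))).exists
  -- Sandwich `N ε ε ≤ N ε η ≤ N η η`, where both ends equal `a` and the middle equals `b`.
  have h1 : N ε η ≤ N η η := hmono ε η η η hε.1 hε.2.le hηE hη le_rfl hηE
  have h2 : N ε ε ≤ N ε η := hmono ε ε ε η hε.1 le_rfl (hε.2.trans hηE) hε.1 hε.2.le hηE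
  have h3 : N η η = a := hu' hηu
  have h4 : N ε ε = a := hu' ⟨hε.1, hε.2.trans hηu.2⟩
  omega

end Germs

/-! ### Layers of a decreasing count and their endpoints -/

section Layers

/-- The indices `i` whose layer `{s > a | i < c s}` ends exactly at `t`. -/
def layer (a : EReal) (c : ℝ → ℕ) (t : EReal) : Set ℕ :=
  {i | a < t ∧ (∀ s : ℝ, a < s → (s : EReal) < t → i < c s) ∧
    ∀ s : ℝ, t < (s : EReal) → c s ≤ i}

variable {a : EReal} {c : ℝ → ℕ}

theorem exists_mem_layer (hc : ∀ s s' : ℝ, a < s → s ≤ s' → c s' ≤ c s) {s : ℝ} {i : ℕ}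
    (hs : a < s) (hi : i < c s) : ∃ t, i ∈ layer a c t := by
  -- The supremum is taken in `EReal`, so a layer that never ends gets the endpoint `⊤`.
  refine ⟨sSup ((fun s : ℝ => (s : EReal)) '' {s : ℝ | a < s ∧ i < c s}), ?_, ?_, ?_⟩
  · exact hs.trans_le (le_sSup ⟨s, ⟨hs, hi⟩, rfl⟩)
  · intro s' h1 h2
    obtain ⟨_, ⟨u, ⟨hu1, hu2⟩, rfl⟩, hu⟩ := lt_sSup_iff.1 h2
    exact hu2.trans_le (hc s' u h1 (EReal.coe_le_coe_iff.1 hu.le))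
  · intro s' h
    by_contra! h'
    have h1 : a < (s' : EReal) := by
      refine hs.trans_le (le_trans (le_sSup ?_) h.le)
      exact ⟨s, ⟨hs, hi⟩, rfl⟩
    exact absurd h (not_lt.2 (le_sSup ⟨s', ⟨h1, h'⟩, rfl⟩))

theorem layer_unique {t t' : EReal} {i : ℕ} (h : i ∈ layer a c t) (h' : i ∈ layer a c t') :
    t = t' := by
  by_contra hne
  wlog hlt : t < t' generalizing t t'
  · exact this h' h (Ne.symm hne) (lt_of_le_of_ne (not_lt.1 hlt) (Ne.symm hne))
  obtain ⟨s, h1, h2⟩ := EReal.lt_iff_exists_real_btwn.1 hlt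
  exact absurd (h'.2.1 s (h.1.trans h1) h2) (not_lt.2 (h.2.2 s h1))

theorem layer_exists_lt {t : EReal} {i : ℕ} (h : i ∈ layer a c t) :
    ∃ s : ℝ, a < s ∧ (s : EReal) < t ∧ i < c s := by
  obtain ⟨s, h1, h2⟩ := EReal.lt_iff_exists_real_btwn.1 h.1
  exact ⟨s, h1, h2, h.2.1 s h1 h2⟩

/-- The layers ending at `t` are those with index between the right and left limits of `c` at `t`,
so the jump counts them. -/
theorem layer_ncard_coe (hc : ∀ s s' : ℝ, a < s → s ≤ s' → c s' ≤ c s) {t : ℝ} (ht : a < t)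
    {m : ℕ} (hm : ∀ᶠ ε in 𝓝[>] (0 : ℝ), c (t - ε) = c (t + ε) + m) :
    (layer a c t).Finite ∧ (layer a c t).ncard = m := by
  have hD : ∀ᶠ ε in 𝓝[>] (0 : ℝ), a < ((t - ε : ℝ) : EReal) := by
    obtain ⟨s, h1, h2⟩ := EReal.lt_iff_exists_real_btwn.1 ht
    have h2 : s < t := EReal.coe_lt_coe_iff.1 h2
    filter_upwards [Ioo_mem_nhdsGT (sub_pos.2 h2)] with ε hε
    exact h1.trans (EReal.coe_lt_coe_iff.2 (by linarith [hε.2]))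
  obtain ⟨E, hE, hsub⟩ := mem_nhdsGT_iff_exists_Ioo_subset.1 (hm.and hD)
  have hE : 0 < E := hE
  -- As `ε` shrinks, `c (t + ε)` can only rise and `c (t - ε)` can only fall; their difference is
  -- constant, so both are constant.
  have hconst : ∀ ε₁ ε₂, 0 < ε₁ → ε₁ ≤ ε₂ → ε₂ < E →
      c (t + ε₁) = c (t + ε₂) ∧ c (t - ε₁) = c (t - ε₂) := by
    intro ε₁ ε₂ h0 h1 h2
    have e1 := hsub ⟨h0, h1.trans_lt h2⟩
    have e2 := hsub ⟨h0.trans_le h1, h2⟩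
    have e3 := hc (t - ε₂) (t - ε₁) e2.2 (by linarith)
    have e4 := hc (t + ε₁) (t + ε₂) (ht.trans (EReal.coe_lt_coe_iff.2 (by linarith)))
      (by linarith)
    have e5 := e1.1
    have e6 := e2.1
    omega
  have hhalf := hsub ⟨half_pos hE, half_lt_self hE⟩
  have heq : layer a c t = Set.Ico (c (t + E / 2)) (c (t + E / 2) + m) := by
    ext i
    constructor
    · rintro ⟨-, h1, h2⟩
      refine ⟨h2 _ (EReal.coe_lt_coe_iff.2 (by linarith)), ?_⟩
      rw [← hhalf.1]
      exact h1 _ hhalf.2 (EReal.coe_lt_coe_iff.2 (by linarith))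
    · rintro ⟨h1, h2⟩
      refine ⟨ht, fun s hs hst => ?_, fun s hs => ?_⟩
      · have hst : s < t := EReal.coe_lt_coe_iff.1 hst
        have hpos : 0 < min (t - s) (E / 2) := lt_min (by linarith) (by linarith)
        have e1 := hconst _ _ hpos (min_le_right _ _) (half_lt_self hE)
        have e2 := hc s (t - min (t - s) (E / 2)) hs (by linarith [min_le_left (t - s) (E / 2)])
        rw [e1.2, hhalf.1] at e2
        omega
      · have hst : t < s := EReal.coe_lt_coe_iff.1 hs
        have hpos : 0 < min (s - t) (E / 2) := lt_min (by linarith) (by linarith)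
        have e1 := hconst _ _ hpos (min_le_right _ _) (half_lt_self hE)
        have e2 := hc (t + min (s - t) (E / 2)) s
          (ht.trans (EReal.coe_lt_coe_iff.2 (by linarith)))
          (by linarith [min_le_left (s - t) (E / 2)])
        rw [e1.1] at e2
        omega
  rw [heq]
  refine ⟨Set.finite_Ico _ _, ?_⟩
  rw [← Finset.coe_Ico, ncard_coe_finset, Nat.card_Ico]
  omega

theorem layer_ncard_top (hc : ∀ s s' : ℝ, a < s → s ≤ s' → c s' ≤ c s) (ha : a < ⊤)
    {m : ℕ} (hm : ∀ᶠ s in atTop, c s = m) :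
    (layer a c ⊤).Finite ∧ (layer a c ⊤).ncard = m := by
  have heq : layer a c ⊤ = Set.Iio m := by
    ext i
    constructor
    · rintro ⟨-, h1, -⟩
      obtain ⟨u, hu, -⟩ := EReal.lt_iff_exists_real_btwn.1 ha
      obtain ⟨s, hs, hsu⟩ := (hm.and (eventually_ge_atTop u)).exists
      have := h1 s (hu.trans_le (EReal.coe_le_coe_iff.2 hsu)) (EReal.coe_lt_top s)
      rwa [hs] at this
    · intro hi
      refine ⟨ha, fun s hs _ => ?_, fun s hs => absurd hs (not_lt.2 le_top)⟩
      obtain ⟨s', hs', hss'⟩ := (hm.and (eventually_ge_atTop s)).exists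
      have := hc s s' hs hss'
      rw [hs'] at this
      exact lt_of_lt_of_le hi this
  rw [heq]
  refine ⟨Set.finite_Iio _, ?_⟩
  rw [← Finset.coe_Iio, ncard_coe_finset, Nat.card_Iio]

/-- If an endpoint moved too far, a real in the gap would lie inside the `i`-th layer of one count
while its shift lay beyond that of the other, against the comparison of the counts. -/
theorem layer_compare {a₁ a₂ : EReal} {c₁ c₂ : ℝ → ℕ} {p q : ℝ} {t₁ t₂ : EReal} {i : ℕ}
    (ha : ∀ s : ℝ, a₂ < s → a₁ < ((s + p : ℝ) : EReal))
    (h₁₂ : ∀ s : ℝ, a₁ < s → c₁ s ≤ c₂ (s - p)) (h₂₁ : ∀ s : ℝ, a₁ < s → c₂ (s + q) ≤ c₁ s)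
    (ha' : ∀ s : ℝ, a₁ < s → a₂ < ((s + q : ℝ) : EReal))
    (h₁ : i ∈ layer a₁ c₁ t₁) (h₂ : i ∈ layer a₂ c₂ t₂) :
    t₁ ≤ t₂ + (p : EReal) ∧ t₂ ≤ t₁ + (q : EReal) := by
  constructor
  · by_contra! hlt
    obtain ⟨s, h3, h4⟩ := EReal.lt_iff_exists_real_btwn.1 hlt
    have h5 : t₂ < ((s - p : ℝ) : EReal) := by
      rw [EReal.coe_sub]
      exact EReal.lt_sub_iff_add_lt (by simp) (by simp) |>.2 h3
    have h6 : a₁ < s := by simpa using ha (s - p) (h₂.1.trans h5)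
    have h7 := h₁.2.1 s h6 h4
    have h8 := h₂.2.2 _ h5
    have h9 := h₁₂ s h6
    omega
  · by_contra! hlt
    obtain ⟨s, h3, h4⟩ := EReal.lt_iff_exists_real_btwn.1 hlt
    have h5 : t₁ < ((s - q : ℝ) : EReal) := by
      rw [EReal.coe_sub]
      exact EReal.lt_sub_iff_add_lt (by simp) (by simp) |>.2 h3
    have h6 : a₁ < ((s - q : ℝ) : EReal) := h₁.1.trans h5
    have h7 := h₂.2.1 s (by simpa using ha' _ h6) h4
    have h8 := h₁.2.2 _ h5
    have h9 := h₂₁ _ h6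
    rw [sub_add_cancel] at h9
    omega

end Layers

end SizeTheory

/-! ### Rank functions and their cornerpoint counts along lines -/

namespace SizeTheory

/-- The properties shared by the size functions of continuous functions on compact locally
connected spaces and by their variants with two measuring functions. -/
structure IsRank (r : ℝ → ℝ → ℕ) : Prop where
  mono_left : ∀ {x x' y : ℝ}, x ≤ x' → x' < y → r x y ≤ r x' y
  supermodular : ∀ {x x' y y' : ℝ}, x ≤ x' → x' < y → y ≤ y' →
    r x' y' + r x y ≤ r x' y + r x y'
  eventually_zero : ∃ c : ℝ, ∀ x < c, ∀ y > x, r x y = 0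

variable {r : ℝ → ℝ → ℕ}

/-- This is supermodularity against an abscissa so small that the rank vanishes there. -/
theorem IsRank.anti_right (hr : IsRank r) {x y y' : ℝ} (hxy : x < y) (hy : y ≤ y') :
    r x y' ≤ r x y := by
  obtain ⟨c, hc⟩ := hr.eventually_zero
  have hlt : min x (c - 1) < c := (min_le_right _ _).trans_lt (by linarith)
  have hle : min x (c - 1) ≤ x := min_le_left _ _
  have h1 := hr.supermodular hle hxy hy
  rw [hc _ hlt _ (hle.trans_lt hxy), hc _ hlt _ (hle.trans_lt (hxy.trans_le hy))] at h1
  omega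

/-- The number of cornerpoints, with multiplicity, of abscissa `x` and ordinate above `s`. -/
noncomputable def birthCount (r : ℝ → ℝ → ℕ) (x s : ℝ) : ℕ :=
  germ (fun ε => x + ε < s) fun ε => (r (x + ε) s : ℤ) - r (x - ε) s

/-- The number of cornerpoints, with multiplicity, of ordinate `y` and abscissa up to `s`. -/
noncomputable def deathCount (r : ℝ → ℝ → ℕ) (y : EReal) (s : ℝ) : ℕ :=
  if y = ⊤ then germ (fun ε => s < 1 / ε) fun ε => (r s (1 / ε) : ℤ)
  else germ (fun ε => s < y.toReal - ε) fun ε => (r s (y.toReal - ε) : ℤ) - r s (y.toReal + ε)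

theorem eventually_add_lt {x y : ℝ} (h : x < y) : ∀ᶠ ε in 𝓝[>] (0 : ℝ), x + ε < y := by
  filter_upwards [Ioo_mem_nhdsGT (sub_pos.2 h)] with ε hε
  linarith [hε.2]

theorem eventually_lt_one_div (s : ℝ) : ∀ᶠ ε in 𝓝[>] (0 : ℝ), s < 1 / ε := by
  simp only [one_div]
  exact tendsto_inv_nhdsGT_zero.eventually (eventually_gt_atTop s)

theorem eventually_atTop_of_one_div {p : ℝ → Prop} (h : ∀ᶠ ε in 𝓝[>] (0 : ℝ), p (1 / ε)) :
    ∀ᶠ s in atTop, p s := by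
  have := tendsto_inv_atTop_nhdsGT_zero.eventually h
  filter_upwards [this] with s hs
  simpa using hs

theorem IsRank.birthCount_spec (hr : IsRank r) {x s : ℝ} (h : x < s) :
    ∀ᶠ ε in 𝓝[>] (0 : ℝ), x + ε < s ∧ (r (x + ε) s : ℤ) - r (x - ε) s = birthCount r x s := by
  refine eventually_germ (eventually_add_lt h) (fun ε h0 hA => ?_) (fun ε ε' h0 hle hA => ?_)
  · have := hr.mono_left (x := x - ε) (by linarith) hA
    omega
  · have hA' : x + ε < s := by linarith
    have h1 := hr.mono_left (x := x + ε) (x' := x + ε') (by linarith) hA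
    have h2 := hr.mono_left (x := x - ε') (x' := x - ε) (y := s) (by linarith) (by linarith)
    exact ⟨hA', by omega⟩

theorem IsRank.deathCount_coe_spec (hr : IsRank r) {s y : ℝ} (h : s < y) :
    ∀ᶠ ε in 𝓝[>] (0 : ℝ), s < y - ε ∧
      (r s (y - ε) : ℤ) - r s (y + ε) = deathCount r (y : EReal) s := by
  rw [deathCount, if_neg (EReal.coe_ne_top y), EReal.toReal_coe]
  refine eventually_germ ?_ (fun ε h0 hA => ?_) (fun ε ε' h0 hle hA => ?_)
  · filter_upwards [eventually_add_lt h] with ε hε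
    linarith
  · have := hr.anti_right hA (y' := y + ε) (by linarith)
    omega
  · have hA' : s < y - ε := by linarith
    have h1 := hr.anti_right hA (y' := y - ε) (by linarith)
    have h2 := hr.anti_right (x := s) (y := y + ε) (y' := y + ε') (by linarith) (by linarith)
    exact ⟨hA', by omega⟩

theorem IsRank.deathCount_top_spec (hr : IsRank r) (s : ℝ) :
    ∀ᶠ z in atTop, s < z ∧ r s z = deathCount r ⊤ s := by
  rw [deathCount, if_pos rfl]
  apply eventually_atTop_of_one_div
  have := eventually_germ (N := fun ε => (r s (1 / ε) : ℤ)) (eventually_lt_one_div s)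
    (fun ε h0 hA => by positivity) (fun ε ε' h0 hle hA => ?_)
  · filter_upwards [this] with ε hε
    exact ⟨hε.1, by exact_mod_cast hε.2⟩
  · have h1 : 1 / ε' ≤ 1 / ε := one_div_le_one_div_of_le h0 hle
    exact ⟨hA.trans_le h1, by exact_mod_cast hr.anti_right hA h1⟩

/-- Both counts are strip differences at one common small `ε`, where the hypothesis compares them.
-/
theorem birthCount_le {r' : ℝ → ℝ → ℕ} (hr : IsRank r) (hr' : IsRank r') {x s s' : ℝ}
    (hs : x < s) (hs' : x < s')
    (h : ∀ u u' : ℝ, u ≤ u' → u' < s → u' < s' → r u' s + r' u s' ≤ r' u' s' + r u s) :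
    birthCount r x s ≤ birthCount r' x s' := by
  obtain ⟨ε, ⟨⟨h1, h2⟩, h3, h4⟩, h0⟩ :=
    (((hr.birthCount_spec hs).and (hr'.birthCount_spec hs')).and self_mem_nhdsWithin).exists
  have h0 : 0 < ε := h0
  have := h (x - ε) (x + ε) (by linarith) h1 h3
  omega

theorem deathCount_le {r' : ℝ → ℝ → ℕ} (hr : IsRank r) (hr' : IsRank r') {y : EReal}
    {s s' h : ℝ} (hy : (s : EReal) < y)
    (hy' : (s' : EReal) < y + (h : EReal))
    (hbox : ∀ z z' : ℝ, s < z → s' < z + h → z ≤ z' →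
      r s z + r' s' (z' + h) ≤ r' s' (z + h) + r s z')
    (htop : ∀ z : ℝ, s < z → s' < z + h → r s z ≤ r' s' (z + h)) :
    deathCount r y s ≤ deathCount r' (y + (h : EReal)) s' := by
  induction y with
  | bot => simp at hy
  | coe y =>
    have hsy : s < y := EReal.coe_lt_coe_iff.1 hy
    rw [← EReal.coe_add] at hy' ⊢
    have hsy' : s' < y + h := EReal.coe_lt_coe_iff.1 hy'
    obtain ⟨ε, ⟨⟨h1, h2⟩, h3, h4⟩, h0⟩ :=
      (((hr.deathCount_coe_spec hsy).and
        (hr'.deathCount_coe_spec hsy')).and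
          self_mem_nhdsWithin).exists
    have h0 : 0 < ε := h0
    have := hbox (y - ε) (y + ε) h1 (by linarith) (by linarith)
    rw [show y + ε + h = y + h + ε by ring, show y - ε + h = y + h - ε by ring] at this
    omega
  | top =>
    rw [EReal.top_add_coe]
    have ht : Tendsto (fun z : ℝ => z + h) atTop atTop := tendsto_atTop_add_const_right _ _ tendsto_id
    obtain ⟨z, ⟨h1, h2⟩, h3, h4⟩ :=
      ((hr.deathCount_top_spec s).and (ht.eventually (hr'.deathCount_top_spec s'))).exists
    have := htop z h1 h3
    omega

theorem IsRank.birthCount_anti (hr : IsRank r) {x s s' : ℝ} (hs : x < s) (hss : s ≤ s') :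
    birthCount r x s' ≤ birthCount r x s :=
  birthCount_le hr hr (hs.trans_le hss) hs fun _ _ hu _ hs => hr.supermodular hu hs hss

theorem IsRank.deathCount_mono (hr : IsRank r) {y : EReal} {s s' : ℝ} (hs : s' ≤ s)
    (hy : (s : EReal) < y) : deathCount r y s' ≤ deathCount r y s := by
  induction y with
  | bot => simp at hy
  | coe y =>
    have hsy : s < y := EReal.coe_lt_coe_iff.1 hy
    obtain ⟨ε, ⟨⟨h1, h2⟩, h3, h4⟩, h0⟩ :=
      (((hr.deathCount_coe_spec hsy).and
        (hr.deathCount_coe_spec (s := s') (hs.trans_lt hsy))).and self_mem_nhdsWithin).exists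
    have h0 : 0 < ε := h0
    have := hr.supermodular hs h1 (y' := y + ε) (by linarith)
    omega
  | top =>
    obtain ⟨z, ⟨h1, h2⟩, h3, h4⟩ :=
      ((hr.deathCount_top_spec s).and (hr.deathCount_top_spec s')).exists
    have := hr.mono_left hs h1
    omega

theorem IsRank.deathCount_eq_zero (hr : IsRank r) {y : EReal} {s : ℝ} (hy : (s : EReal) < y)
    (h : ∀ z > s, r s z = 0) : deathCount r y s = 0 := by
  induction y with
  | bot => simp at hy
  | coe y =>
    obtain ⟨ε, ⟨h1, h2⟩, h0⟩ :=
      ((hr.deathCount_coe_spec (EReal.coe_lt_coe_iff.1 hy)).and self_mem_nhdsWithin).exists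
    have h0 : 0 < ε := h0
    rw [h _ h1, h (y + ε) (by linarith)] at h2
    omega
  | top =>
    obtain ⟨z, h1, h2⟩ := (hr.deathCount_top_spec s).exists
    rw [← h2, h z h1]

/-- The alternating sum of the values of `r` at the corners of a box centred at `(x, y)`. -/
def boxCount (r : ℝ → ℝ → ℕ) (x y ε η : ℝ) : ℤ :=
  (r (x + ε) (y - η) : ℤ) - r (x - ε) (y - η) - r (x + ε) (y + η) + r (x - ε) (y + η)

theorem IsRank.boxCount_nonneg (hr : IsRank r) {x y ε η : ℝ} (hε : 0 < ε) (hη : 0 < η)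
    (h : x + ε < y - η) : 0 ≤ boxCount r x y ε η := by
  have := hr.supermodular (x := x - ε) (y' := y + η) (by linarith) h (by linarith)
  unfold boxCount
  omega

theorem IsRank.boxCount_mono (hr : IsRank r) {x y ε₁ ε₂ η₁ η₂ : ℝ} (hε₁ : 0 < ε₁) (hε : ε₁ ≤ ε₂)
    (hη₁ : 0 < η₁) (hη : η₁ ≤ η₂) (h : x + ε₂ < y - η₂) :
    boxCount r x y ε₁ η₁ ≤ boxCount r x y ε₂ η₂ := by
  -- The large box is the small one plus four boxes of nonnegative count: below, above, and then
  -- right and left over the full height.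
  have h1 := hr.supermodular (x := x - ε₁) (x' := x + ε₁) (y := y - η₂) (y' := y - η₁)
    (by linarith) (by linarith) (by linarith)
  have h2 := hr.supermodular (x := x - ε₁) (x' := x + ε₁) (y := y + η₁) (y' := y + η₂)
    (by linarith) (by linarith) (by linarith)
  have h3 := hr.supermodular (x := x + ε₁) (x' := x + ε₂) (y := y - η₂) (y' := y + η₂)
    (by linarith) (by linarith) (by linarith)
  have h4 := hr.supermodular (x := x - ε₂) (x' := x - ε₁) (y := y - η₂) (y' := y + η₂)
    (by linarith) (by linarith) (by linarith)
  unfold boxCount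
  omega

/-- `ExtPoint` contains points on and below the diagonal; there the multiplicity must agree with the
empty layer. -/
theorem cornerMult_finite_eq_zero {x y : ℝ} (h : y ≤ x) : cornerMult r (.finite x y) = 0 := by
  have : {n : ℕ | ∃ ε : ℝ, 0 < ε ∧ x + ε < y - ε ∧ (n : ℤ) = boxCount r x y ε ε} = ∅ := by
    ext n
    simp only [mem_ofPred_eq, mem_empty_iff_false, iff_false]
    rintro ⟨ε, h0, h1, -⟩
    linarith
  exact (congrArg sInf this).trans Nat.sInf_empty

theorem IsRank.cornerMult_finite_spec (hr : IsRank r) {x y : ℝ} (h : x < y) :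
    ∀ᶠ ε in 𝓝[>] (0 : ℝ), boxCount r x y ε ε = cornerMult r (.finite x y) := by
  have := eventually_germ (A := fun ε => x + ε < y - ε) (N := fun ε => boxCount r x y ε ε) ?_
    (fun ε h0 hA => hr.boxCount_nonneg h0 h0 hA)
    (fun ε ε' h0 hle hA => ⟨by linarith, hr.boxCount_mono h0 hle h0 hle hA⟩)
  · exact this.mono fun ε hε => hε.2
  · filter_upwards [eventually_add_lt (show x < (x + y) / 2 by linarith)] with ε hε
    linarith

theorem IsRank.strip_mono (hr : IsRank r) {x ε₁ ε₂ z₁ z₂ : ℝ} (hε₁ : 0 < ε₁) (hε : ε₁ ≤ ε₂)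
    (hz : z₂ ≤ z₁) (h : x + ε₂ < z₂) :
    (r (x + ε₁) z₁ : ℤ) - r (x - ε₁) z₁ ≤ r (x + ε₂) z₂ - r (x - ε₂) z₂ := by
  have h1 := hr.supermodular (x := x - ε₁) (x' := x + ε₁) (y := z₂) (y' := z₁)
    (by linarith) (by linarith) hz
  have h2 := hr.mono_left (x := x + ε₁) (x' := x + ε₂) (y := z₂) (by linarith) h
  have h3 := hr.mono_left (x := x - ε₂) (x' := x - ε₁) (y := z₂) (by linarith) (by linarith)
  omega

theorem IsRank.cornerMult_infinite_spec (hr : IsRank r) (x : ℝ) :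
    ∀ᶠ ε in 𝓝[>] (0 : ℝ),
      (r (x + ε) (1 / ε) : ℤ) - r (x - ε) (1 / ε) = cornerMult r (.infinite x) := by
  have := eventually_germ (A := fun ε => x + ε < 1 / ε)
    (N := fun ε => (r (x + ε) (1 / ε) : ℤ) - r (x - ε) (1 / ε)) ?_
    (fun ε h0 hA => ?_) (fun ε ε' h0 hle hA => ?_)
  · exact this.mono fun ε hε => hε.2
  · filter_upwards [eventually_add_lt (lt_add_one x), eventually_lt_one_div (x + 1)] with ε h1 h2
    linarith
  · have := hr.mono_left (x := x - ε) (by linarith) hA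
    omega
  · have h1 : 1 / ε' ≤ 1 / ε := one_div_le_one_div_of_le h0 hle
    exact ⟨by linarith, hr.strip_mono h0 hle h1 hA⟩

/-- The jump is the iterated germ of `boxCount` (width to `0` first, then height), while the
multiplicity is its diagonal germ; `diagonal_germ_eq` identifies them. -/
theorem IsRank.birthCount_jump (hr : IsRank r) {x y : ℝ} (h : x < y) :
    ∀ᶠ η in 𝓝[>] (0 : ℝ), birthCount r x (y - η) =
      birthCount r x (y + η) + cornerMult r (.finite x y) := by
  have hA : ∀ᶠ η in 𝓝[>] (0 : ℝ), x < y - η :=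
    (eventually_add_lt h).mono fun η hη => by linarith
  have hJ := eventually_germ (A := fun η => x < y - η)
    (N := fun η => (birthCount r x (y - η) : ℤ) - birthCount r x (y + η)) hA
    (fun η h0 hA => ?_) (fun η η' h0 hle hA => ?_)
  · generalize germ _ _ = b at hJ
    have hcb := diagonal_germ_eq (N := fun ε η => boxCount r x y ε η) (b := b)
      (show 0 < (y - x) / 2 by linarith)
      (fun ε₁ ε₂ η₁ η₂ h1 h2 h3 h4 h5 h6 => hr.boxCount_mono h1 h2 h4 h5 (by linarith))
      (hr.cornerMult_finite_spec h) ?_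
    · filter_upwards [hJ] with η hη
      omega
    · filter_upwards [hJ, self_mem_nhdsWithin] with η ⟨hη, hη'⟩ h0
      have h0 : 0 < η := h0
      filter_upwards [hr.birthCount_spec hη,
        hr.birthCount_spec (show x < y + η by linarith)] with ε h1 h2
      unfold boxCount
      omega
  · have := hr.birthCount_anti hA (s' := y + η) (by linarith)
    omega
  · have h1 := hr.birthCount_anti hA (s' := y - η) (by linarith)
    have h2 := hr.birthCount_anti (x := x) (s := y + η) (s' := y + η') (by linarith) (by linarith)
    exact ⟨by linarith, by omega⟩

theorem IsRank.birthCount_limit (hr : IsRank r) (x : ℝ) :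
    ∀ᶠ s in atTop, birthCount r x s = cornerMult r (.infinite x) := by
  have hJ := eventually_germ (N := fun η => (birthCount r x (1 / η) : ℤ))
    (eventually_lt_one_div x) (fun η h0 hA => by positivity) (fun η η' h0 hle hA => ?_)
  · generalize germ _ _ = b at hJ
    obtain ⟨E, hE, hE'⟩ : ∃ E : ℝ, 0 < E ∧ x + E < 1 / E := by
      obtain ⟨E, ⟨h1, h2⟩, h3⟩ := (((eventually_add_lt (lt_add_one x)).and
        (eventually_lt_one_div (x + 1))).and self_mem_nhdsWithin).exists
      exact ⟨E, h3, by linarith⟩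
    have hcb := diagonal_germ_eq (b := b)
      (N := fun ε η => (r (x + ε) (1 / η) : ℤ) - r (x - ε) (1 / η)) hE
      (fun ε₁ ε₂ η₁ η₂ h1 h2 h3 h4 h5 h6 => hr.strip_mono h1 h2
        (one_div_le_one_div_of_le h4 h5)
        (by have := one_div_le_one_div_of_le (h4.trans_le h5) h6.le; linarith))
      (hr.cornerMult_infinite_spec x) ?_
    · apply eventually_atTop_of_one_div
      filter_upwards [hJ] with η hη
      omega
    · filter_upwards [hJ] with η ⟨hη, hη'⟩
      filter_upwards [hr.birthCount_spec hη] with ε h1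
      omega
  · have h1 : 1 / η' ≤ 1 / η := one_div_le_one_div_of_le h0 hle
    exact ⟨hA.trans_le h1, by exact_mod_cast hr.birthCount_anti hA h1⟩

/-- Monotonicity alone makes the jump stabilize. Its value is identified afterwards, by boxes for
finite `y` and by strips for `y = ⊤`. -/
theorem IsRank.deathCount_jump_aux (hr : IsRank r) {x : ℝ} {y : EReal} (h : (x : EReal) < y) :
    ∃ b : ℕ, ∀ᶠ ε in 𝓝[>] (0 : ℝ), ((x + ε : ℝ) : EReal) < y ∧
      (deathCount r y (x + ε) : ℤ) - deathCount r y (x - ε) = b := by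
  refine ⟨_, eventually_germ (A := fun ε => ((x + ε : ℝ) : EReal) < y)
    (N := fun ε => (deathCount r y (x + ε) : ℤ) - deathCount r y (x - ε)) ?_
    (fun ε h0 hA => ?_) (fun ε ε' h0 hle hA => ?_)⟩
  · obtain ⟨u, h1, h2⟩ := EReal.lt_iff_exists_real_btwn.1 h
    filter_upwards [eventually_add_lt (EReal.coe_lt_coe_iff.1 h1)] with ε hε
    exact (EReal.coe_lt_coe_iff.2 hε).trans h2
  · have := hr.deathCount_mono (s' := x - ε) (by linarith) hA
    omega
  · have hA' : ((x + ε : ℝ) : EReal) < y := (EReal.coe_le_coe_iff.2 (by linarith)).trans_lt hA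
    have h1 := hr.deathCount_mono (s' := x + ε) (by linarith) hA
    have h2 := hr.deathCount_mono (s := x - ε) (s' := x - ε') (by linarith)
      ((EReal.coe_le_coe_iff.2 (by linarith)).trans_lt hA')
    exact ⟨hA', by omega⟩

theorem IsRank.deathCount_jump_coe (hr : IsRank r) {x y : ℝ} (h : x < y) :
    ∀ᶠ ε in 𝓝[>] (0 : ℝ), deathCount r (y : EReal) (x + ε) =
      deathCount r (y : EReal) (x - ε) + cornerMult r (.finite x y) := by
  obtain ⟨b, hJ⟩ := hr.deathCount_jump_aux (EReal.coe_lt_coe_iff.2 h)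
  have hcb := diagonal_germ_eq (N := fun η ε => boxCount r x y ε η) (b := b)
    (show 0 < (y - x) / 2 by linarith)
    (fun ε₁ ε₂ η₁ η₂ h1 h2 h3 h4 h5 h6 => hr.boxCount_mono h4 h5 h1 h2 (by linarith))
    (hr.cornerMult_finite_spec h) ?_
  · filter_upwards [hJ] with η hη
    omega
  · filter_upwards [hJ, self_mem_nhdsWithin] with ε ⟨hε, hε'⟩ h0
    have h0 : 0 < ε := h0
    have hε : x + ε < y := EReal.coe_lt_coe_iff.1 hε
    filter_upwards [hr.deathCount_coe_spec hε,
      hr.deathCount_coe_spec (show x - ε < y by linarith)] with η h1 h2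
    unfold boxCount
    omega

theorem IsRank.deathCount_jump_top (hr : IsRank r) (x : ℝ) :
    ∀ᶠ ε in 𝓝[>] (0 : ℝ), deathCount r ⊤ (x + ε) =
      deathCount r ⊤ (x - ε) + cornerMult r (.infinite x) := by
  obtain ⟨b, hJ⟩ := hr.deathCount_jump_aux (EReal.coe_lt_top x)
  obtain ⟨E, hE, hE'⟩ : ∃ E : ℝ, 0 < E ∧ x + E < 1 / E := by
    obtain ⟨E, ⟨h1, h2⟩, h3⟩ := (((eventually_add_lt (lt_add_one x)).and
      (eventually_lt_one_div (x + 1))).and self_mem_nhdsWithin).exists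
    exact ⟨E, h3, by linarith⟩
  have hcb := diagonal_germ_eq (b := b)
    (N := fun η ε => (r (x + ε) (1 / η) : ℤ) - r (x - ε) (1 / η)) hE
    (fun ε₁ ε₂ η₁ η₂ h1 h2 h3 h4 h5 h6 => hr.strip_mono h4 h5
      (one_div_le_one_div_of_le h1 h2)
      (by have := one_div_le_one_div_of_le (h1.trans_le h2) h3.le; linarith))
    (hr.cornerMult_infinite_spec x) ?_
  · filter_upwards [hJ] with η hη
    omega
  · filter_upwards [hJ] with ε ⟨hε, hε'⟩
    have ht : Tendsto (fun η : ℝ => 1 / η) (𝓝[>] 0) atTop := by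
      simpa only [one_div] using tendsto_inv_nhdsGT_zero
    filter_upwards [ht.eventually (hr.deathCount_top_spec (x + ε)),
      ht.eventually (hr.deathCount_top_spec (x - ε))] with η h1 h2
    omega

end SizeTheory

/-! ### Labelled cornerpoints and the two injections -/

namespace SizeTheory

/-- The abscissa of a point. -/
def ExtPoint.birth : ExtPoint → ℝ
  | .finite x _ => x
  | .infinite x => x

/-- The ordinate of a point, possibly infinite. -/
noncomputable def ExtPoint.death : ExtPoint → EReal
  | .finite _ y => y
  | .infinite _ => ⊤

theorem ExtPoint.ext_birth_death {p q : ExtPoint} (hb : p.birth = q.birth)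
    (hd : p.death = q.death) : p = q := by
  cases p <;> cases q <;> simp_all [ExtPoint.birth, ExtPoint.death]

theorem ExtPoint.exists_birth_death (x : ℝ) {t : EReal} (ht : t ≠ ⊥) :
    ∃ p : ExtPoint, p.birth = x ∧ p.death = t := by
  induction t with
  | bot => exact absurd rfl ht
  | coe y => exact ⟨.finite x y, rfl, rfl⟩
  | top => exact ⟨.infinite x, rfl, rfl⟩

/-- The labels of the cornerpoint `p` among the cornerpoints of the same abscissa, listed by
decreasing ordinate. -/
noncomputable def birthLayer (r : ℝ → ℝ → ℕ) (p : ExtPoint) : Set ℕ :=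
  layer p.birth (birthCount r p.birth) p.death

/-- The labels of the cornerpoint `p` among the cornerpoints of the same ordinate, listed by
increasing abscissa. -/
noncomputable def deathLayer (r : ℝ → ℝ → ℕ) (p : ExtPoint) : Set ℕ :=
  layer (-p.death) (fun t => deathCount r p.death (-t)) ((-p.birth : ℝ) : EReal)

theorem layer_eq_empty {a t : EReal} {c : ℝ → ℕ} (h : t ≤ a) : layer a c t = ∅ := by
  ext i
  simp only [layer, mem_ofPred_eq, mem_empty_iff_false, iff_false]
  exact fun hi => absurd hi.1 (not_lt.2 h)

variable {r : ℝ → ℝ → ℕ}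

theorem IsRank.birthLayer_ncard (hr : IsRank r) (p : ExtPoint) :
    (birthLayer r p).Finite ∧ (birthLayer r p).ncard = cornerMult r p := by
  have hanti : ∀ x s s' : ℝ, (x : EReal) < s → s ≤ s' → birthCount r x s' ≤ birthCount r x s :=
    fun x s s' hs hss => hr.birthCount_anti (EReal.coe_lt_coe_iff.1 hs) hss
  cases p with
  | finite x y =>
    rcases lt_or_ge x y with h | h
    · exact layer_ncard_coe (hanti x) (EReal.coe_lt_coe_iff.2 h) (hr.birthCount_jump h)
    · rw [birthLayer, layer_eq_empty, cornerMult_finite_eq_zero h]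
      · simp
      · exact EReal.coe_le_coe_iff.2 h
  | infinite x =>
    exact layer_ncard_top (hanti x) (EReal.coe_lt_top x) (hr.birthCount_limit x)

theorem coe_neg_lt_of_neg_lt {y : EReal} {s : ℝ} (h : -y < (s : EReal)) :
    ((-s : ℝ) : EReal) < y := by
  rw [EReal.coe_neg]
  exact EReal.neg_lt_comm.1 h

theorem IsRank.deathCount_neg_anti (hr : IsRank r) (y : EReal) (s s' : ℝ) (hs : -y < (s : EReal))
    (hss : s ≤ s') : deathCount r y (-s') ≤ deathCount r y (-s) :=
  hr.deathCount_mono (neg_le_neg hss) (coe_neg_lt_of_neg_lt hs)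

theorem IsRank.deathLayer_ncard (hr : IsRank r) (p : ExtPoint) :
    (deathLayer r p).Finite ∧ (deathLayer r p).ncard = cornerMult r p := by
  cases p with
  | finite x y =>
    rcases lt_or_ge x y with h | h
    · refine layer_ncard_coe (hr.deathCount_neg_anti _) ?_ ?_
      · change -(y : EReal) < ((-x : ℝ) : EReal)
        rw [← EReal.coe_neg]
        exact EReal.coe_lt_coe_iff.2 (neg_lt_neg h)
      · filter_upwards [hr.deathCount_jump_coe h] with ε hε
        rw [show -(-(ExtPoint.finite x y).birth - ε) = x + ε by simp [ExtPoint.birth, add_comm],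
          show -(-(ExtPoint.finite x y).birth + ε) = x - ε by simp [ExtPoint.birth, sub_eq_add_neg, add_comm]]
        exact hε
    · rw [deathLayer, layer_eq_empty, cornerMult_finite_eq_zero h]
      · simp
      · change ((-x : ℝ) : EReal) ≤ -(y : EReal)
        rw [← EReal.coe_neg]
        exact EReal.coe_le_coe_iff.2 (neg_le_neg h)
  | infinite x =>
    refine layer_ncard_coe (hr.deathCount_neg_anti _) ?_ ?_
    · change -(⊤ : EReal) < ((-x : ℝ) : EReal)
      rw [EReal.neg_top]
      exact EReal.bot_lt_coe _
    · filter_upwards [hr.deathCount_jump_top x] with ε hε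
      rw [show -(-(ExtPoint.infinite x).birth - ε) = x + ε by simp [ExtPoint.birth, add_comm],
        show -(-(ExtPoint.infinite x).birth + ε) = x - ε by simp [ExtPoint.birth, sub_eq_add_neg, add_comm]]
      exact hε

/-- The cornerpoints of `r`, repeated according to their multiplicities. -/
abbrev Corner (r : ℝ → ℝ → ℕ) : Type := Σ p : ExtPoint, Fin (cornerMult r p)

/-- A relation between points that identifies the labels of two families of label sets induces an
injection between the corresponding multisets of cornerpoints. -/
theorem exists_corner_injection {r₁ r₂ : ℝ → ℝ → ℕ} {L₁ L₂ : ExtPoint → Set ℕ}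
    (h₁ : ∀ p, (L₁ p).Finite ∧ (L₁ p).ncard = cornerMult r₁ p)
    (h₂ : ∀ p, (L₂ p).Finite ∧ (L₂ p).ncard = cornerMult r₂ p)
    {R : ExtPoint → ExtPoint → Prop} {B : ExtPoint → Prop}
    (hex : ∀ p, ∀ i ∈ L₁ p, ∃ q, i ∈ L₂ q ∧ R p q)
    (hinj : ∀ p p' q i, i ∈ L₁ p → i ∈ L₁ p' → R p q → R p' q → p = p')
    (huniq : ∀ p q q' i, i ∈ L₂ q → i ∈ L₂ q' → R p q → R p q' → q = q')
    (hcover : ∀ q, B q → ∀ i ∈ L₂ q, ∃ p, i ∈ L₁ p ∧ R p q) :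
    ∃ f : Corner r₁ → Corner r₂, Function.Injective f ∧ (∀ a, R a.1 (f a).1) ∧
      ∀ b, B b.1 → b ∈ range f := by
  have equiv : ∀ {L : ExtPoint → Set ℕ} {r : ℝ → ℝ → ℕ},
      (∀ p, (L p).Finite ∧ (L p).ncard = cornerMult r p) →
      ∃ e : ∀ p, Fin (cornerMult r p) → ℕ, ∀ p, Function.Injective (e p) ∧
        range (e p) = L p := by
    intro L r h
    have : ∀ p, ∃ e : Fin (cornerMult r p) → ℕ, Function.Injective e ∧ range e = L p := by
      intro p
      have : Finite (L p) := (h p).1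
      let e := (Finite.equivFinOfCardEq (α := L p) (h p).2).symm
      refine ⟨fun k => e k, Subtype.val_injective.comp e.injective, ?_⟩
      rw [show (fun k => ((e k : L p) : ℕ)) = Subtype.val ∘ e from rfl, range_comp, e.range_eq_univ]
      simp
    exact ⟨fun p => (this p).choose, fun p => (this p).choose_spec⟩
  obtain ⟨e₁, he₁⟩ := equiv h₁
  obtain ⟨e₂, he₂⟩ := equiv h₂
  have mem₁ : ∀ a : Corner r₁, e₁ a.1 a.2 ∈ L₁ a.1 := fun a => (he₁ a.1).2 ▸ mem_range_self _
  have mem₂ : ∀ a : Corner r₂, e₂ a.1 a.2 ∈ L₂ a.1 := fun a => (he₂ a.1).2 ▸ mem_range_self _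
  have ext₁ : ∀ a a' : Corner r₁, a.1 = a'.1 → e₁ a.1 a.2 = e₁ a'.1 a'.2 → a = a' := by
    rintro ⟨p, k⟩ ⟨p', k'⟩ (rfl : p = p') h
    exact congrArg (Sigma.mk p) ((he₁ p).1 h)
  have ext₂ : ∀ a a' : Corner r₂, a.1 = a'.1 → e₂ a.1 a.2 = e₂ a'.1 a'.2 → a = a' := by
    rintro ⟨p, k⟩ ⟨p', k'⟩ (rfl : p = p') h
    exact congrArg (Sigma.mk p) ((he₂ p).1 h)
  have hf : ∀ a : Corner r₁, ∃ b : Corner r₂, R a.1 b.1 ∧ e₂ b.1 b.2 = e₁ a.1 a.2 := by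
    intro a
    obtain ⟨q, hq, hR⟩ := hex _ _ (mem₁ a)
    rw [← (he₂ q).2] at hq
    obtain ⟨k, hk⟩ := hq
    exact ⟨⟨q, k⟩, hR, hk⟩
  choose f hfR hfe using hf
  refine ⟨f, fun a a' haa => ?_, hfR, fun b hb => ?_⟩
  · have he : e₁ a.1 a.2 = e₁ a'.1 a'.2 := by rw [← hfe, ← hfe, haa]
    refine ext₁ a a' (hinj a.1 a'.1 (f a).1 _ (mem₁ a) (he ▸ mem₁ a') (hfR a) ?_) he
    rw [haa]
    exact hfR a'
  · obtain ⟨p, hp, hR⟩ := hcover _ hb _ (mem₂ b)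
    have hp' := hp
    rw [← (he₁ p).2] at hp'
    obtain ⟨k, hk⟩ := hp'
    have he : e₂ (f ⟨p, k⟩).1 (f ⟨p, k⟩).2 = e₂ b.1 b.2 := (hfe ⟨p, k⟩).trans hk
    refine ⟨⟨p, k⟩, ext₂ _ _ (huniq p _ _ _ (mem₂ _) ?_ (hfR ⟨p, k⟩) hR) he⟩
    rw [he]
    exact mem₂ b

/-- On each vertical line the two hypotheses give `c_I(s) ≤ c_V(s)` and `c_V(s + η) ≤ c_I(s)` for
the counts by ordinate; matching equal labels moves the ordinate up by at most `η`. -/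
theorem exists_birth_injection {I V : ℝ → ℝ → ℕ} (hI : IsRank I) (hV : IsRank V) {η : ℝ}
    (hη : 0 ≤ η)
    (hIV : ∀ x x' y : ℝ, x ≤ x' → x' < y → I x' y + V x y ≤ V x' y + I x y)
    (hVI : ∀ x x' y : ℝ, x ≤ x' → x' < y → V x' (y + η) + I x y ≤ I x' y + V x (y + η)) :
    ∃ f : Corner I → Corner V, Function.Injective f ∧
      (∀ a, (f a).1.birth = a.1.birth ∧ a.1.death ≤ (f a).1.death ∧
        (f a).1.death ≤ a.1.death + (η : EReal)) ∧
      ∀ b : Corner V, ((b.1.birth + η : ℝ) : EReal) < b.1.death → b ∈ range f := by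
  have c₁ : ∀ x s : ℝ, (x : EReal) < s → birthCount I x s ≤ birthCount V x (s - 0) := by
    intro x s hs
    have hs : x < s := EReal.coe_lt_coe_iff.1 hs
    rw [sub_zero]
    exact birthCount_le hI hV hs hs fun u u' hu hu' _ => hIV u u' s hu hu'
  have c₂ : ∀ x s : ℝ, (x : EReal) < s → birthCount V x (s + η) ≤ birthCount I x s := by
    intro x s hs
    have hs : x < s := EReal.coe_lt_coe_iff.1 hs
    exact birthCount_le hV hI (by linarith) hs fun u u' hu _ hu' => hVI u u' s hu hu'
  have cmp : ∀ p q i, i ∈ birthLayer I p → i ∈ birthLayer V q → q.birth = p.birth →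
      q.birth = p.birth ∧ p.death ≤ q.death ∧ q.death ≤ p.death + (η : EReal) := by
    intro p q i hp hq hb
    unfold birthLayer at hq
    rw [hb] at hq
    have := layer_compare (p := 0) (q := η) (by simp) (c₁ _) (c₂ _) (fun s hs =>
      hs.trans_le (EReal.coe_le_coe_iff.2 (by linarith))) hp hq
    rw [EReal.coe_zero, add_zero] at this
    exact ⟨hb, this⟩
  have ex : ∀ {r : ℝ → ℝ → ℕ}, IsRank r → ∀ {x s : ℝ} {i : ℕ}, (x : EReal) < s →
      i < birthCount r x s → ∃ q : ExtPoint, i ∈ birthLayer r q ∧ q.birth = x := by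
    intro r hr x s i hs hi
    obtain ⟨t, ht⟩ := exists_mem_layer
      (fun s s' hs hss => hr.birthCount_anti (EReal.coe_lt_coe_iff.1 hs) hss) hs hi
    obtain ⟨q, rfl, rfl⟩ := ExtPoint.exists_birth_death x (ne_bot_of_gt ht.1)
    exact ⟨q, ht, rfl⟩
  refine exists_corner_injection (B := fun q => ((q.birth + η : ℝ) : EReal) < q.death)
    (R := fun p q => q.birth = p.birth ∧ p.death ≤ q.death ∧ q.death ≤ p.death + (η : EReal))
    hI.birthLayer_ncard hV.birthLayer_ncard ?_ ?_ ?_ ?_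
  · intro p i hp
    obtain ⟨s, h1, -, h3⟩ := layer_exists_lt hp
    have h4 := c₁ _ s h1
    rw [sub_zero] at h4
    obtain ⟨q, hq, hb⟩ := ex hV h1 (h3.trans_le h4)
    exact ⟨q, hq, cmp p q i hp hq hb⟩
  · intro p p' q i hp hp' hR hR'
    have hb := hR.1.symm.trans hR'.1
    unfold birthLayer at hp hp'
    rw [hb] at hp
    exact ExtPoint.ext_birth_death hb (layer_unique hp hp')
  · intro p q q' i hq hq' hR hR'
    have hb := hR.1.trans hR'.1.symm
    unfold birthLayer at hq hq'
    rw [hb] at hq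
    exact ExtPoint.ext_birth_death hb (layer_unique hq hq')
  · intro q hB i hq
    -- The gap exceeds `η`, so `s` can be chosen below the ordinate with `s - η` still above the
    -- abscissa; there the count of `I` exceeds `i`.
    obtain ⟨s, h1, h2⟩ := EReal.lt_iff_exists_real_btwn.1 hB
    have h1 : q.birth + η < s := EReal.coe_lt_coe_iff.1 h1
    have h3 : (q.birth : EReal) < ((s - η : ℝ) : EReal) :=
      EReal.coe_lt_coe_iff.2 (by linarith)
    have h4 := hq.2.1 s (EReal.coe_lt_coe_iff.2 (by linarith)) h2
    have h5 := c₂ _ _ h3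
    rw [sub_add_cancel] at h5
    obtain ⟨p, hp, hb⟩ := ex hI h3 (h4.trans_le h5)
    exact ⟨p, hp, cmp p q i hp hq hb.symm⟩

/-- The horizontal analogue: the line at ordinate `y` for `I` is matched with the one at `y + h` for
`W`. Abscissas are negated so that the counts decrease. The last two hypotheses serve the line at
infinity. -/
theorem exists_death_injection {I W : ℝ → ℝ → ℕ} (hI : IsRank I) (hW : IsRank W) {h : ℝ}
    (hh : 0 ≤ h)
    (hIW : ∀ x y y' : ℝ, x < y → y ≤ y' →
      I x y + W (x + h) (y' + h) ≤ W (x + h) (y + h) + I x y')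
    (hWI : ∀ x y y' : ℝ, x < y → y ≤ y' →
      W (x - h) (y + h) + I x y' ≤ I x y + W (x - h) (y' + h))
    (hIW' : ∀ x y : ℝ, x < y → I x y ≤ W (x + h) (y + h))
    (hWI' : ∀ x y : ℝ, x < y → W (x - h) (y + h) ≤ I x y) :
    ∃ f : Corner I → Corner W, Function.Injective f ∧
      (∀ a, (f a).1.death = a.1.death + (h : EReal) ∧ a.1.birth - h ≤ (f a).1.birth ∧
        (f a).1.birth ≤ a.1.birth + h) ∧
      ∀ b : Corner W, ((b.1.birth + 2 * h : ℝ) : EReal) < b.1.death → b ∈ range f := by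
  have dom : ∀ (y : EReal) (s t : ℝ), t ≤ s + h → ((s : ℝ) : EReal) < y →
      ((t : ℝ) : EReal) < y + (h : EReal) := by
    intro y s t ht hs
    refine lt_of_le_of_lt (EReal.coe_le_coe_iff.2 ht) ?_
    rw [EReal.coe_add]
    exact EReal.add_lt_add_right_coe hs h
  have c₁ : ∀ (y : EReal) (s : ℝ), -y < (s : EReal) →
      deathCount I y (-s) ≤ deathCount W (y + (h : EReal)) (-(s - h)) := by
    intro y s hs
    refine deathCount_le hI hW (coe_neg_lt_of_neg_lt hs)
      (dom y (-s) _ (by linarith) (coe_neg_lt_of_neg_lt hs)) ?_ ?_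
    · intro z z' hz _ hzz
      have := hIW (-s) z z' hz hzz
      rwa [show -s + h = -(s - h) by ring] at this
    · intro z hz _
      have := hIW' (-s) z hz
      rwa [show -s + h = -(s - h) by ring] at this
  have c₂ : ∀ (y : EReal) (s : ℝ), -y < (s : EReal) →
      deathCount W (y + (h : EReal)) (-(s + h)) ≤ deathCount I y (-s) := by
    intro y s hs
    have hs' := coe_neg_lt_of_neg_lt hs
    have := deathCount_le (s := -(s + h)) (s' := -s) (y := y + (h : EReal)) (h := -h) hW hI
      (dom y (-s) _ (by linarith) hs')
      (by rwa [EReal.coe_neg h, ← sub_eq_add_neg, EReal.add_sub_cancel_right]) ?_ ?_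
    · rwa [EReal.coe_neg, ← sub_eq_add_neg, EReal.add_sub_cancel_right] at this
    · intro z z' _ hz hzz
      have := hWI (-s) (z + -h) (z' + -h) hz (by linarith)
      simpa [show -s - h = -(s + h) by ring] using this
    · intro z _ hz
      have := hWI' (-s) (z + -h) hz
      simpa [show -s - h = -(s + h) by ring] using this
  have neg_dom : ∀ (y : EReal) (s t : ℝ), s - h ≤ t → -y < (s : EReal) →
      -(y + (h : EReal)) < (t : EReal) := by
    intro y s t ht hs
    have := dom y (-s) (-t) (by linarith) (coe_neg_lt_of_neg_lt hs)
    rw [EReal.neg_lt_comm, ← EReal.coe_neg]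
    exact this
  have dom_back : ∀ (y : EReal) (s : ℝ), -(y + (h : EReal)) < (s : EReal) →
      -y < ((s + h : ℝ) : EReal) := by
    intro y s hs
    rw [EReal.neg_lt_comm, ← EReal.coe_neg] at hs ⊢
    rw [show -(s + h) = -s - h by ring, EReal.coe_sub]
    exact EReal.sub_lt_of_lt_add hs
  have cmp : ∀ p q i, i ∈ deathLayer I p → i ∈ deathLayer W q →
      q.death = p.death + (h : EReal) →
      q.death = p.death + (h : EReal) ∧ p.birth - h ≤ q.birth ∧ q.birth ≤ p.birth + h := by
    intro p q i hp hq hd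
    unfold deathLayer at hq
    rw [hd] at hq
    have := layer_compare (p := h) (q := h) (dom_back _) (c₁ _) (c₂ _)
      (fun s hs => neg_dom _ s _ (by linarith) hs) hp hq
    simp only [← EReal.coe_add, EReal.coe_le_coe_iff] at this
    exact ⟨hd, by linarith [this.2], by linarith [this.1]⟩
  have ex : ∀ {r : ℝ → ℝ → ℕ}, IsRank r → ∀ {y : EReal} {s : ℝ} {i : ℕ}, -y < (s : EReal) →
      i < deathCount r y (-s) → ∃ q : ExtPoint, i ∈ deathLayer r q ∧ q.death = y := by
    intro r hr y s i hs hi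
    obtain ⟨t, ht⟩ := exists_mem_layer (c := fun t => deathCount r y (-t))
      (hr.deathCount_neg_anti y) hs hi
    have hy : y ≠ ⊥ := by
      rintro rfl
      simp at hs
    have ht' : t ≠ ⊤ := by
      -- A layer with endpoint `⊤` would mean cornerpoints of arbitrarily negative abscissa, where
      -- the rank vanishes.
      rintro rfl
      obtain ⟨c, hc⟩ := hr.eventually_zero
      have hlt : -y < ((max s (1 - c) : ℝ) : EReal) :=
        hs.trans_le (EReal.coe_le_coe_iff.2 (le_max_left _ _))
      have h1 := ht.2.1 _ hlt (EReal.coe_lt_top _)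
      have h2 := hr.deathCount_eq_zero (coe_neg_lt_of_neg_lt hlt)
        (hc _ (by linarith [le_max_right s (1 - c)]))
      simp only [h2] at h1
      omega
    lift t to ℝ using ⟨ht', ne_bot_of_gt ht.1⟩
    obtain ⟨q, hqb, rfl⟩ := ExtPoint.exists_birth_death (-t) hy
    refine ⟨q, ?_, rfl⟩
    unfold deathLayer
    rwa [hqb, neg_neg]
  refine exists_corner_injection (B := fun q => ((q.birth + 2 * h : ℝ) : EReal) < q.death)
    (R := fun p q => q.death = p.death + (h : EReal) ∧ p.birth - h ≤ q.birth ∧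
      q.birth ≤ p.birth + h)
    hI.deathLayer_ncard hW.deathLayer_ncard ?_ ?_ ?_ ?_
  · intro p i hp
    obtain ⟨s, h1, -, h3⟩ := layer_exists_lt hp
    obtain ⟨q, hq, hd⟩ := ex hW (neg_dom _ s _ le_rfl h1) (h3.trans_le (c₁ _ s h1))
    exact ⟨q, hq, cmp p q i hp hq hd⟩
  · intro p p' q i hp hp' hR hR'
    have hd : p.death = p'.death := by
      have := congrArg (· - (h : EReal)) (hR.1.symm.trans hR'.1)
      simpa only [EReal.add_sub_cancel_right] using this
    unfold deathLayer at hp hp'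
    rw [hd] at hp
    have := EReal.coe_eq_coe_iff.1 (layer_unique hp hp')
    exact ExtPoint.ext_birth_death (neg_injective this) hd
  · intro p q q' i hq hq' hR hR'
    have hd := hR.1.trans hR'.1.symm
    unfold deathLayer at hq hq'
    rw [hd] at hq
    have := EReal.coe_eq_coe_iff.1 (layer_unique hq hq')
    exact ExtPoint.ext_birth_death (neg_injective this) hd
  · intro q hB i hq
    obtain ⟨y, hy⟩ : ∃ y : EReal, q.death = y + (h : EReal) :=
      ⟨q.death - h, (EReal.sub_add_cancel).symm⟩
    unfold deathLayer at hq
    rw [hy] at hq hB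
    -- The count of `W` is read at `u - 2h`, right of the abscissa of `q`, and that of `I` at `u -
    -- h`, which lies below `y`; hence the threshold `2h`.
    obtain ⟨u, h1, h2⟩ := EReal.lt_iff_exists_real_btwn.1 hB
    have h1 : q.birth + 2 * h < u := EReal.coe_lt_coe_iff.1 h1
    have h3 : ((u - h : ℝ) : EReal) < y := by
      rw [EReal.coe_sub]
      exact EReal.sub_lt_of_lt_add h2
    have h4 : -y < ((-(u - h) : ℝ) : EReal) := by
      rw [EReal.coe_neg]
      exact EReal.neg_lt_neg_iff.2 h3
    have h5 := hq.2.1 (-(u - h) + h) (neg_dom y _ _ (by linarith) h4)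
      (EReal.coe_lt_coe_iff.2 (by linarith))
    obtain ⟨p, hp, hd⟩ := ex hI h4 (h5.trans_le (c₂ y _ h4))
    refine ⟨p, hp, cmp p q i hp ?_ (hy.trans (by rw [hd]))⟩
    unfold deathLayer
    rwa [hy]

end SizeTheory

namespace SizeTheory

/-! ### From partial matchings to bijections of diagrams -/

section Matching

open Cardinal in
-- The diagonal has the cardinality of the continuum, and there are at most that many cornerpoints,
-- so it absorbs any set of them.
theorem corner_sum_diagonal_equiv {r : ℝ → ℝ → ℕ} (S : Set (Corner r)) :
    Nonempty (S ⊕ (ℝ × ℕ) ≃ ℝ × ℕ) := by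
  classical
  have hD : #(ℝ × ℕ) = 𝔠 := by simp [mk_real]
  have hle : #(Corner r) ≤ 𝔠 := by
    let g : Corner r → ℝ × ℝ × Bool × ℕ := fun a =>
      (a.1.birth, a.1.death.toReal, decide (a.1.death = ⊤), a.2)
    have hg : Function.Injective g := by
      rintro ⟨p, k⟩ ⟨p', k'⟩ h
      simp only [g, Prod.mk.injEq] at h
      obtain ⟨h1, h2, h3, h4⟩ := h
      have hp : p = p' := by
        cases p <;> cases p' <;> simp_all [ExtPoint.birth, ExtPoint.death]
      subst hp
      exact congrArg (Sigma.mk p) (Fin.ext h4)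
    refine (mk_le_of_injective hg).trans ?_
    simp [mk_real]
  rw [← Cardinal.eq, mk_sum, lift_id, lift_id, hD]
  exact add_eq_right aleph0_le_continuum ((mk_set_le S).trans hle)

/-- A partial matching, given by two injections of a common type, extends to a bijection after
adding to both sides a type that absorbs the unmatched elements. -/
theorem exists_equiv_of_partial_matching {A B O D : Type*} {f : O → A} {g : O → B}
    (hf : Function.Injective f) (hg : Function.Injective g)
    (hA : Nonempty (((range f)ᶜ : Set A) ⊕ D ≃ D)) (hB : Nonempty (((range g)ᶜ : Set B) ⊕ D ≃ D))
    {P : A ⊕ D → B ⊕ D → Prop} (h₁ : ∀ o, P (.inl (f o)) (.inl (g o)))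
    (h₂ : ∀ a ∉ range f, ∀ d, P (.inl a) (.inr d)) (h₃ : ∀ b ∉ range g, ∀ d, P (.inr d) (.inl b))
    (h₄ : ∀ d d', P (.inr d) (.inr d')) :
    ∃ σ : A ⊕ D ≃ B ⊕ D, ∀ x, P x (σ x) := by
  classical
  obtain ⟨eA⟩ := hA
  obtain ⟨eB⟩ := hB
  let e₀ : range f ≃ range g := (Equiv.ofInjective f hf).symm.trans (Equiv.ofInjective g hg)
  let sA := Equiv.Set.sumCompl (range f)
  let sB := Equiv.Set.sumCompl (range g)
  -- The source copy of `D` is split by `eB` to supply partners for the unmatched part of `B`; the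
  -- target copy absorbs the unmatched part of `A` by `eA`.
  let σ : A ⊕ D ≃ B ⊕ D :=
    (Equiv.sumCongr sA.symm eB.symm).trans <|
      (Equiv.sumSumSumComm _ _ _ _).trans <|
        Equiv.sumCongr ((Equiv.sumCongr e₀ (Equiv.refl _)).trans sB) eA
  refine ⟨σ, ?_⟩
  rintro (a | d)
  · by_cases ha : a ∈ range f
    · obtain ⟨o, rfl⟩ := ha
      have : σ (.inl (f o)) = .inl (g o) := by
        have h0 : sA.symm (f o) = .inl (Equiv.ofInjective f hf o) :=
          Equiv.Set.sumCompl_symm_apply_of_mem (mem_range_self o)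
        simp [σ, h0, e₀, sB]
      rw [this]
      exact h₁ o
    · have : ∃ d, σ (.inl a) = .inr d := by
        have h0 : sA.symm a = .inr ⟨a, ha⟩ := Equiv.Set.sumCompl_symm_apply_of_notMem ha
        exact ⟨eA (.inl ⟨a, ha⟩), by simp [σ, h0]⟩
      obtain ⟨d, hd⟩ := this
      rw [hd]
      exact h₂ a ha d
  · rcases hd : eB.symm d with b | d'
    · have : σ (.inr d) = .inl b.1 := by simp [σ, hd, sB]
      rw [this]
      exact h₃ _ b.2 d
    · have : σ (.inr d) = .inr (eA (.inr d')) := by simp [σ, hd]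
      rw [this]
      exact h₄ _ _

theorem moveCost_le_of_close {p q : ExtPoint} {h : ℝ} (hb : |p.birth - q.birth| ≤ h)
    (h₁ : p.death ≤ q.death + (h : EReal)) (h₂ : q.death ≤ p.death + (h : EReal)) :
    moveCost p q ≤ ENNReal.ofReal h := by
  cases p with
  | finite x y =>
    cases q with
    | finite x' y' =>
      apply ENNReal.ofReal_le_ofReal
      simp only [ExtPoint.death, ← EReal.coe_add, EReal.coe_le_coe_iff] at h₁ h₂
      exact (min_le_left _ _).trans (max_le hb (abs_le.2 ⟨by linarith, by linarith⟩))
    | infinite x' => simp [ExtPoint.death, ← EReal.coe_add] at h₂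
  | infinite x =>
    cases q with
    | finite x' y' => simp [ExtPoint.death, ← EReal.coe_add] at h₁
    | infinite x' => exact ENNReal.ofReal_le_ofReal hb

/-- The second alternative in the cost ignores the position on the diagonal, so `z` is arbitrary and
the absorbing bijections need no geometric control. -/
theorem moveCost_diagonal_le {p : ExtPoint} {h : ℝ} (hh : 0 ≤ h)
    (hp : p.death ≤ ((p.birth + 2 * h : ℝ) : EReal)) (z : ℝ) :
    moveCost p (.finite z z) ≤ ENNReal.ofReal h ∧ moveCost (.finite z z) p ≤ ENNReal.ofReal h := by
  cases p with
  | finite x y =>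
    simp only [ExtPoint.death, ExtPoint.birth, EReal.coe_le_coe_iff] at hp
    have h1 : (y - x) / 2 ≤ h := by linarith
    have h2 : (z - z) / 2 ≤ h := by simpa using hh
    exact ⟨ENNReal.ofReal_le_ofReal ((min_le_right _ _).trans (max_le h1 h2)),
      ENNReal.ofReal_le_ofReal ((min_le_right _ _).trans (max_le h2 h1))⟩
  | infinite x => exact absurd (top_le_iff.1 hp) (EReal.coe_ne_top _)

end Matching

/-! ### One-dimensional stability -/

section Stability

theorem lowerLevel_subset {M : Type*} {F G : M → ℝ} {x y : ℝ} (h : ∀ P, F P ≤ x → G P ≤ y) :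
    lowerLevel F x ⊆ lowerLevel G y := h

variable {M : Type*} [TopologicalSpace M]

theorem IsRank.congr {r r' : ℝ → ℝ → ℕ} (hr : IsRank r) (h : ∀ x y, x < y → r' x y = r x y) :
    IsRank r' where
  mono_left {x x' y} hx hxy := by
    rw [h _ _ hxy, h _ _ (hx.trans_lt hxy)]
    exact hr.mono_left hx hxy
  supermodular {x x' y y'} hx hxy hy := by
    rw [h _ _ hxy, h _ _ (hx.trans_lt hxy), h _ _ (hxy.trans_le hy),
      h _ _ ((hx.trans_lt hxy).trans_le hy)]
    exact hr.supermodular hx hxy hy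
  eventually_zero := by
    obtain ⟨c, hc⟩ := hr.eventually_zero
    exact ⟨c, fun x hx y hy => (h _ _ hy).trans (hc x hx y hy)⟩

variable [CompactSpace M] [LocallyConnectedSpace M] {F G : M → ℝ}

/-- For `x < y` the open set `{G < y + h}` separates the two level sets, which gives the finiteness
behind the inequalities. -/
theorem isRank_compCount (hF : Continuous F) (hG : Continuous G) {h : ℝ}
    (hFG : ∀ P, G P ≤ F P + h) :
    IsRank fun x y => compCount (lowerLevel F x) (lowerLevel G (y + h)) where
  mono_left {x x' y} hx hxy := compCount_mono_left
    (lowerLevel_subset fun P hP => hP.trans hx)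
    (finite_components_lowerLevel hF hG fun P hP => by linarith [hFG P])
  supermodular {x x' y y'} hx hxy hy := compCount_supermodular
    (lowerLevel_subset fun P hP => hP.trans hx)
    (lowerLevel_subset fun P hP => by linarith [hFG P])
    (lowerLevel_subset fun P hP => by linarith)
    (finite_components_lowerLevel hF hG fun P hP => by linarith [hFG P])
  eventually_zero := by
    obtain ⟨c, hc⟩ := (isCompact_range hF).bddBelow
    refine ⟨c, fun x hx y _ => ?_⟩
    have : lowerLevel F x = ∅ := by
      refine eq_empty_of_forall_notMem fun P hP => ?_
      have h1 : F P ≤ x := hP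
      have h2 : c ≤ F P := hc (mem_range_self P)
      linarith
    simp [this]

theorem isRank_sizeFunction (hF : Continuous F) : IsRank (sizeFunction F) :=
  (isRank_compCount hF hF (h := 0) (fun P => by simp)).congr fun x y hxy => by
    rw [sizeFunction_eq_compCount F hxy.le, add_zero]

/-- A cornerpoint of `I` with ordinate `y` goes to an ordinate in `[y, y + 2h]` for `F` and to `y +
h` for `G`, so the two images differ by at most `h`; likewise their abscissas. -/
theorem matchDist_le_of_close (hF : Continuous F) (hG : Continuous G) {h : ℝ} (hh : 0 ≤ h)
    (hFG : ∀ P, |F P - G P| ≤ h) :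
    matchDist (sizeFunction F) (sizeFunction G) ≤ ENNReal.ofReal h := by
  have h1 : ∀ P, G P ≤ F P + h := fun P => by linarith [(abs_le.1 (hFG P)).1]
  have h2 : ∀ P, F P ≤ G P + h := fun P => by linarith [(abs_le.1 (hFG P)).2]
  have hI := isRank_compCount hF hG h1
  have hV := isRank_sizeFunction hF
  have hW := isRank_sizeFunction hG
  obtain ⟨f, hf, hfR, hfB⟩ := exists_birth_injection hI hV (η := 2 * h) (by linarith)
    (fun x x' y hx hxy => by
      rw [sizeFunction_eq_compCount F (hx.trans hxy.le), sizeFunction_eq_compCount F hxy.le]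
      exact compCount_supermodular (lowerLevel_subset fun P hP => hP.trans hx)
        (lowerLevel_subset fun P hP => hP.trans hxy.le)
        (lowerLevel_subset fun P hP => by linarith [h1 P])
        (finite_components_lowerLevel hF hF fun P hP => by linarith))
    (fun x x' y hx hxy => by
      rw [sizeFunction_eq_compCount F (by linarith), sizeFunction_eq_compCount F (by linarith)]
      exact compCount_supermodular (lowerLevel_subset fun P hP => hP.trans hx)
        (lowerLevel_subset fun P hP => by linarith [h1 P])
        (lowerLevel_subset fun P hP => by linarith [h2 P])
        (finite_components_lowerLevel hF hG fun P hP => by linarith [h1 P]))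
  obtain ⟨g, hg, hgR, hgB⟩ := exists_death_injection hI hW hh
    (fun x y y' hx hy => by
      rw [sizeFunction_eq_compCount G (by linarith), sizeFunction_eq_compCount G (by linarith)]
      have := compCount_supermodular (X := lowerLevel F x) (X' := lowerLevel G (x + h))
        (Y := lowerLevel G (y + h)) (Y' := lowerLevel G (y' + h))
        (lowerLevel_subset fun P hP => by linarith [h1 P])
        (lowerLevel_subset fun P hP => by linarith)
        (lowerLevel_subset fun P hP => by linarith)
        (finite_components_lowerLevel hG hG fun P hP => by linarith)
      omega)
    (fun x y y' hx hy => by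
      rw [sizeFunction_eq_compCount G (by linarith), sizeFunction_eq_compCount G (by linarith)]
      have := compCount_supermodular (X := lowerLevel G (x - h)) (X' := lowerLevel F x)
        (Y := lowerLevel G (y + h)) (Y' := lowerLevel G (y' + h))
        (lowerLevel_subset fun P hP => by linarith [h2 P])
        (lowerLevel_subset fun P hP => by linarith [h1 P])
        (lowerLevel_subset fun P hP => by linarith)
        (finite_components_lowerLevel hF hG fun P hP => by linarith [h1 P])
      omega)
    (fun x y hxy => by
      rw [sizeFunction_eq_compCount G (by linarith)]
      exact compCount_mono_left (lowerLevel_subset fun P hP => by linarith [h1 P])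
        (finite_components_lowerLevel hG hG fun P hP => by linarith))
    (fun x y hxy => by
      rw [sizeFunction_eq_compCount G (by linarith)]
      exact compCount_mono_left (lowerLevel_subset fun P hP => by linarith [h2 P])
        (finite_components_lowerLevel hF hG fun P hP => by linarith [h1 P]))
  obtain ⟨σ, hσ⟩ := exists_equiv_of_partial_matching (D := ℝ × ℕ) hf hg
    (corner_sum_diagonal_equiv _) (corner_sum_diagonal_equiv _)
    (P := fun a b => moveCost (Diagram.point (ℓ := sizeFunction F) a)
      (Diagram.point (ℓ := sizeFunction G) b) ≤ ENNReal.ofReal h)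
    (fun o => by
      obtain ⟨e1, e2, e3⟩ := hfR o
      obtain ⟨e4, e5, e6⟩ := hgR o
      refine moveCost_le_of_close (p := (f o).1) (q := (g o).1) ?_ ?_ ?_
      · rw [e1]
        exact abs_le.2 ⟨by linarith, by linarith⟩
      · rw [e4, add_assoc, ← EReal.coe_add, ← two_mul]
        exact e3
      · rw [e4]
        exact add_le_add_left e2 _)
    (fun a ha d => (moveCost_diagonal_le hh (not_lt.1 fun hlt => ha (hfB a hlt)) d.1).1)
    (fun b hb d => (moveCost_diagonal_le hh (not_lt.1 fun hlt => hb (hgB b hlt)) d.1).2)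
    (fun d d' => (moveCost_diagonal_le (p := .finite d.1 d.1) hh
      (by simp only [ExtPoint.death, ExtPoint.birth, EReal.coe_le_coe_iff]; linarith) d'.1).1)
  exact iInf_le_of_le σ (iSup_le hσ)

end Stability

/-! ### Invariance under homeomorphisms -/

section Homeomorphism

variable {M N : Type*} [TopologicalSpace M] [TopologicalSpace N]

theorem levelConnected_comp_homeomorph {α : Type*} [Preorder α] (f : M ≃ₜ N) (ψ : N → α) (y : α)
    (P Q : M) : LevelConnected (ψ ∘ f) y P Q ↔ LevelConnected ψ y (f P) (f Q) := by
  constructor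
  · rintro ⟨S, hS, hSy, hP, hQ⟩
    refine ⟨f '' S, hS.image f f.continuous.continuousOn, ?_, mem_image_of_mem f hP,
      mem_image_of_mem f hQ⟩
    rintro _ ⟨R, hR, rfl⟩
    exact hSy hR
  · rintro ⟨S, hS, hSy, hP, hQ⟩
    exact ⟨f ⁻¹' S, f.isConnected_preimage.2 hS, fun R hR => hSy hR, hP, hQ⟩

theorem sizeFunction_comp_homeomorph {α : Type*} [Preorder α] (f : M ≃ₜ N) (ψ : N → α) :
    sizeFunction (ψ ∘ f) = sizeFunction ψ := by
  funext x y
  let e : lowerLevel (ψ ∘ f) x ≃ lowerLevel ψ x := f.toEquiv.subtypeEquiv fun _ => Iff.rfl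
  exact Nat.card_congr (Quot.congr e fun P Q => levelConnected_comp_homeomorph f ψ y P Q)

end Homeomorphism

/-! ### Reduction to one-dimensional measuring functions -/

section Reduction

variable {M : Type*} {k : ℕ} [NeZero k]

theorem continuous_reduced [TopologicalSpace M] (l b : Fin k → ℝ) {φ : M → Fin k → ℝ}
    (hφ : Continuous φ) : Continuous (reduced l b φ) := by
  unfold reduced
  refine Continuous.finset_sup'_apply _ fun i _ => ?_
  exact (((continuous_apply i).comp hφ).sub continuous_const).div_const _

theorem minCoord_pos {l : Fin k → ℝ} (hl : ∀ i, 0 < l i) : 0 < minCoord l :=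
  (Finset.lt_inf'_iff _).2 fun i _ => hl i

theorem reduced_sub_le {N : Type*} {l : Fin k → ℝ} (hl : ∀ i, 0 < l i) (b : Fin k → ℝ)
    {φ : M → Fin k → ℝ} {ψ : N → Fin k → ℝ} {P : M} {Q : N} {c : ℝ} (hc : 0 ≤ c)
    (h : ∀ i, φ P i ≤ ψ Q i + c) :
    reduced l b φ P ≤ reduced l b ψ Q + c / minCoord l := by
  refine Finset.sup'_le _ _ fun i _ => ?_
  have h1 : (ψ Q i - b i) / l i ≤ reduced l b ψ Q :=
    Finset.le_sup' (fun i => (ψ Q i - b i) / l i) (Finset.mem_univ i)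
  have h2 : c / l i ≤ c / minCoord l :=
    div_le_div_of_nonneg_left hc (minCoord_pos hl) (Finset.inf'_le _ (Finset.mem_univ i))
  have h3 : (φ P i - b i) / l i ≤ (ψ Q i - b i) / l i + c / l i := by
    rw [← add_div]
    exact div_le_div_of_nonneg_right (by linarith [h i]) (hl i).le
  linarith

end Reduction

variable {M N : Type*} [TopologicalSpace M] [TopologicalSpace N] [CompactSpace M] {k : ℕ}

theorem naturalPseudoDist_ne_top {φ : M → Fin k → ℝ} {ψ : N → Fin k → ℝ}
    (hφ : Continuous φ) (hψ : Continuous ψ) (hMN : Nonempty (M ≃ₜ N)) :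
    naturalPseudoDist φ ψ ≠ ⊤ := by
  obtain ⟨f⟩ := hMN
  obtain ⟨C, hC⟩ :=
    (isCompact_range (hφ.dist (hψ.comp f.continuous))).bddAbove
  refine ne_top_of_le_ne_top (ENNReal.ofReal_ne_top (r := C))
    (iInf_le_of_le f (iSup_le fun P => ?_))
  rw [edist_dist]
  exact ENNReal.ofReal_le_ofReal (hC (mem_range_self P))

theorem multiMatchDist_le_naturalPseudoDist [LocallyConnectedSpace M] [NeZero k]
    {φ : M → Fin k → ℝ} {ψ : N → Fin k → ℝ} (hφ : Continuous φ) (hψ : Continuous ψ) :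
    multiMatchDist φ ψ ≤ naturalPseudoDist φ ψ := by
  refine iSup₂_le fun ⟨l, b⟩ hp => le_iInf fun f => ?_
  have hl : ∀ i, 0 < l i := hp.1
  -- Stability needs a real bound on the displacement; an infinite one makes the inequality trivial.
  rcases eq_or_ne (⨆ P : M, edist (φ P) (ψ (f P))) ⊤ with htop | htop
  · rw [htop]
    exact le_top
  obtain ⟨c, hc⟩ : ∃ c : NNReal, (⨆ P : M, edist (φ P) (ψ (f P))) = c :=
    ⟨_, (ENNReal.coe_toNNReal htop).symm⟩
  have hdist : ∀ P i, |φ P i - ψ (f P) i| ≤ c := by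
    intro P i
    have h1 : edist (φ P) (ψ (f P)) ≤ c := hc ▸ le_iSup (fun P => edist (φ P) (ψ (f P))) P
    rw [edist_nndist, ENNReal.coe_le_coe] at h1
    exact (dist_le_pi_dist (φ P) (ψ (f P)) i).trans h1
  have hmin := minCoord_pos hl
  have hclose : ∀ P, |reduced l b φ P - (reduced l b ψ ∘ f) P| ≤ c / minCoord l := by
    intro P
    have h1 := reduced_sub_le hl b (φ := φ) (ψ := ψ) (P := P) (Q := f P) c.coe_nonneg
      fun i => by linarith [(abs_le.1 (hdist P i)).2]
    have h2 := reduced_sub_le hl b (φ := ψ) (ψ := φ) (P := f P) (Q := P) c.coe_nonneg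
      fun i => by linarith [(abs_le.1 (hdist P i)).1]
    rw [Function.comp_apply]
    exact abs_le.2 ⟨by linarith, by linarith⟩
  have key := matchDist_le_of_close (continuous_reduced l b hφ)
    ((continuous_reduced l b hψ).comp f.continuous) (div_nonneg c.coe_nonneg hmin.le) hclose
  rw [sizeFunction_comp_homeomorph] at key
  calc ENNReal.ofReal (minCoord l) *
        matchDist (sizeFunction (reduced l b φ)) (sizeFunction (reduced l b ψ))
      ≤ ENNReal.ofReal (minCoord l) * ENNReal.ofReal (c / minCoord l) := mul_le_mul' le_rfl key
    _ = ⨆ P : M, edist (φ P) (ψ (f P)) := by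
      rw [← ENNReal.ofReal_mul hmin.le, mul_div_cancel₀ _ hmin.ne', ENNReal.ofReal_coe_nnreal, hc]

end SizeTheory

theorem theorem2 {M N : Type*} [TopologicalSpace M] [TopologicalSpace N]
    [Nonempty M] [CompactSpace M] [LocallyConnectedSpace M] [T2Space M]
    [Nonempty N] [CompactSpace N] [LocallyConnectedSpace N] [T2Space N]
    {k : ℕ} [NeZero k] (φ : M → Fin k → ℝ) (ψ : N → Fin k → ℝ)
    (hφ : Continuous φ) (hψ : Continuous ψ) (hMN : Nonempty (M ≃ₜ N)) :
    (⨆ p ∈ SizeTheory.Adm k, ENNReal.ofReal (SizeTheory.minCoord p.1) *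
        SizeTheory.matchDist
          (SizeTheory.sizeFunction (SizeTheory.reduced p.1 p.2 φ))
          (SizeTheory.sizeFunction (SizeTheory.reduced p.1 p.2 ψ)))
      ≤ SizeTheory.naturalPseudoDist φ ψ ∧
    SizeTheory.multiMatchDist φ ψ ≤ SizeTheory.naturalPseudoDist φ ψ ∧
    SizeTheory.naturalPseudoDist φ ψ ≠ ⊤ :=
  ⟨SizeTheory.multiMatchDist_le_naturalPseudoDist hφ hψ,
    SizeTheory.multiMatchDist_le_naturalPseudoDist hφ hψ,
    SizeTheory.naturalPseudoDist_ne_top hφ hψ hMN⟩
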